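/- Let $0<b\le+\infty$, let $0=x_0<x_1<x_2<\dots<b$ with $\lim_{n\to\infty}x_n=b$, put $d_n:=x_n-x_{n-1}$ for $n\ge 1$, and assume $\sup_{n\ge1}d_n<\infty$ (the case $\inf_n d_n=0$ is allowed). For an interval $J$ let $W^{2,2}(J)$ be the set of $f\in L^2(J)$ (complex-valued) such that $f,f'$ are locally absolutely continuous on $J$ and $f''\in L^2(J)$. Let $H_{\min}=-\frac{d^2}{dx^2}$ in $L^2[0,b)$ with domain $\{f\in W^{2,2}[0,b): f(x_n)=f'(x_n)=0 \text{ for all } n\ge0\}$, and for $n\ge1$ let $H_n=-\frac{d^2}{dx^2}$ in $L^2[x_{n-1},x_n]$ with domain $W^{2,2}_0[x_{n-1},x_n]=\{f\in W^{2,2}[x_{n-1},x_n]: f=f'=0 \text{ at } x_{n-1} \text{ and } x_n\}$. A boundary triplet for the adjoint $A^*$ of a densely defined closed symmetric operator $A$ in a Hilbert space $\mathfrak H$ is a triplet $\{\mathcal H,\Gamma_0,\Gamma_1\}$, where $\mathcal H$ is a Hilbert space and $\Gamma_0,\Gamma_1:\operatorname{dom}(A^*)\to\mathcal H$ are linear maps,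 bounded with respect to the graph norm of $A^*$, such that $$(A^*f,g)_{\mathfrak H}-(f,A^*g)_{\mathfrak H}=(\Gamma_1f,\Gamma_0g)_{\mathcal H}-(\Gamma_0f,\Gamma_1g)_{\mathcal H}\qquad\text{for all } f,g\in\operatorname{dom}(A^*),$$ and $f\mapsto(\Gamma_0f,\Gamma_1f)$ maps $\operatorname{dom}(A^*)$ onto $\mathcal H\oplus\mathcal H$. Identify $L^2[0,b)$ with $\bigoplus_{n\ge1}L^2[x_{n-1},x_n]$ by $f\mapsto(f_n)_n$, where $f_n$ is the restriction of $f$ to $[x_{n-1},x_n]$. For maps $\Gamma_j^{(n)}:W^{2,2}[x_{n-1},x_n]\to\mathbb C^2$ ($j=0,1$), the direct sum of the triplets $\Pi_n=\{\mathbb C^2,\Gamma_0^{(n)},\Gamma_1^{(n)}\}$ is $\Pi=\{\ell^2(\mathbb N,\mathbb C^2),\Gamma_0,\Gamma_1\}$ with $\Gamma_jf=(\Gamma_j^{(n)}f_n)_n$ and $\operatorname{dom}(\Gamma_j)=\{f\in\operatorname{dom}(H_{\min}^*):\sum_n\|\Gamma_j^{(n)}f_n\|^2<\infty\}$. Then $H_{\min}=\bigoplus_nH_n$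 and $H_{\min}^*=\bigoplus_nH_n^*$. Moreover, for each of the two families $$\text{(A)}\quad \Gamma_0^{(n)}f=\begin{pmatrix}d_n^{1/2}f(x_{n-1}+)\\-d_n^{1/2}f(x_n-)\end{pmatrix},\qquad \Gamma_1^{(n)}f=\begin{pmatrix}d_n^{-3/2}\bigl(d_nf'(x_{n-1}+)+f(x_{n-1}+)-f(x_n-)\bigr)\\ d_n^{-3/2}\bigl(d_nf'(x_n-)+f(x_{n-1}+)-f(x_n-)\bigr)\end{pmatrix},$$ $$\text{(B)}\quad \Gamma_0^{(n)}f=\begin{pmatrix}d_n^{1/2}f(x_{n-1}+)\\d_n^{3/2}f'(x_n-)\end{pmatrix},\qquad \Gamma_1^{(n)}f=\begin{pmatrix}d_n^{-1/2}\bigl(f'(x_{n-1}+)-f'(x_n-)\bigr)\\ d_n^{-3/2}\bigl(f(x_n-)-f(x_{n-1}+)-d_nf'(x_n-)\bigr)\end{pmatrix},$$ where $f\in W^{2,2}[x_{n-1},x_n]$: (i) for every $n\ge1$ the triplet $\Pi_n=\{\mathbb C^2,\Gamma_0^{(n)},\Gamma_1^{(n)}\}$ is a boundary triplet for $H_n^*$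 (in particular $H_n$ is densely defined, closed and symmetric, and $\operatorname{dom}(H_n^*)=W^{2,2}[x_{n-1},x_n]$); (ii) the direct sum $\Pi=\bigoplus_{n\ge1}\Pi_n$ is a boundary triplet for $H_{\min}^*$ (in particular $H_{\min}$ is densely defined, closed and symmetric, and $\operatorname{dom}(\Gamma_0)=\operatorname{dom}(\Gamma_1)=\operatorname{dom}(H_{\min}^*)$). -/

import Mathlib

open MeasureTheory Set Filter Topology

noncomputable section

namespace BoundaryTriplets

/-! ### Abstract boundary triplets -/

section Abstract

variable {E : Type*} [NormedAddCommGroup E] [InnerProductSpace ℂ E] [CompleteSpace E]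
variable {H : Type*} [NormedAddCommGroup H] [InnerProductSpace ℂ H]

/-- `{H, Γ₀, Γ₁}` is a boundary triplet for the adjoint `A†` of the densely defined closed symmetric
operator `A` in `E`. The maps `Γ₀`, `Γ₁` are a priori only partially defined; it is part of the
definition that both are defined exactly on `dom A†`. Boundedness refers to the graph norm of `A†`.
The inner product of Mathlib is linear in its second argument, so `(f, g)` is `inner ℂ g f`. -/
structure IsBoundaryTriplet (A : E →ₗ.[ℂ] E) (Γ₀ Γ₁ : E →ₗ.[ℂ] H) : Prop where
  dense_domain : Dense (A.domain : Set E)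
  isClosed : A.IsClosed
  symmetric : A ≤ A.adjoint
  complete : CompleteSpace H
  dom₀ : Γ₀.domain = A.adjoint.domain
  dom₁ : Γ₁.domain = A.adjoint.domain
  bounded₀ : ∃ C : ℝ, ∀ f : A.adjoint.domain,
    ‖Γ₀ ⟨f, dom₀.ge f.2⟩‖ ^ 2 ≤ C * (‖(f : E)‖ ^ 2 + ‖A.adjoint f‖ ^ 2)
  bounded₁ : ∃ C : ℝ, ∀ f : A.adjoint.domain,
    ‖Γ₁ ⟨f, dom₁.ge f.2⟩‖ ^ 2 ≤ C * (‖(f : E)‖ ^ 2 + ‖A.adjoint f‖ ^ 2)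
  green : ∀ f g : A.adjoint.domain,
    inner ℂ (g : E) (A.adjoint f) - inner ℂ (A.adjoint g) (f : E) =
      inner ℂ (Γ₀ ⟨g, dom₀.ge g.2⟩) (Γ₁ ⟨f, dom₁.ge f.2⟩) -
        inner ℂ (Γ₁ ⟨g, dom₁.ge g.2⟩) (Γ₀ ⟨f, dom₀.ge f.2⟩)
  surjective : ∀ h₀ h₁ : H, ∃ f : A.adjoint.domain,
    Γ₀ ⟨f, dom₀.ge f.2⟩ = h₀ ∧ Γ₁ ⟨f, dom₁.ge f.2⟩ = h₁

end Abstract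

/-! ### Direct sums -/

section DirectSum

variable {G G' : ℕ → Type*}
variable [∀ n, NormedAddCommGroup (G n)] [∀ n, InnerProductSpace ℂ (G n)]
variable [∀ n, NormedAddCommGroup (G' n)] [∀ n, InnerProductSpace ℂ (G' n)]

/-- The direct sum `⊕ₙ Sₙ` between Hilbert direct sums: its domain consists of the `f = (fₙ)` with
`fₙ ∈ dom Sₙ` for all `n` and `∑ ‖Sₙ fₙ‖² < ∞`, and it sends `f` to `(Sₙ fₙ)`. -/
def directSum (S : ∀ n, G n →ₗ.[ℂ] G' n) : lp G 2 →ₗ.[ℂ] lp G' 2 where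
  domain :=
    { carrier := {f | ∃ h : ∀ n, f n ∈ (S n).domain, Memℓp (fun n => S n ⟨f n, h n⟩) 2}
      zero_mem' := by
        refine ⟨fun n => (S n).domain.zero_mem, ?_⟩
        have : (fun n => S n ⟨(0 : lp G 2) n, (S n).domain.zero_mem⟩) = 0 := by
          funext n; exact (S n).map_zero
        rw [this]; exact zero_memℓp
      add_mem' := by
        rintro f g ⟨hf, hf'⟩ ⟨hg, hg'⟩
        refine ⟨fun n => (S n).domain.add_mem (hf n) (hg n), ?_⟩
        have := hf'.add hg'
        convert! this using 1
        funext n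
        exact (S n).map_add ⟨f n, hf n⟩ ⟨g n, hg n⟩
      smul_mem' := by
        rintro c f ⟨hf, hf'⟩
        refine ⟨fun n => (S n).domain.smul_mem c (hf n), ?_⟩
        have := hf'.const_smul c
        convert! this using 1
        funext n
        exact (S n).map_smul c ⟨f n, hf n⟩ }
  toFun :=
    { toFun := fun f => ⟨fun n => S n ⟨(f : lp G 2) n, f.2.choose n⟩, f.2.choose_spec⟩
      map_add' := by
        intro f g
        ext n : 2
        exact (S n).map_add ⟨(f : lp G 2) n, f.2.choose n⟩ ⟨(g : lp G 2) n, g.2.choose n⟩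
      map_smul' := by
        intro c f
        ext n : 2
        exact (S n).map_smul c ⟨(f : lp G 2) n, f.2.choose n⟩ }

/-- The composition `T ∘ U`, with domain `{f | U f ∈ dom T}`. -/
def pullback {E F K : Type*} [NormedAddCommGroup E] [InnerProductSpace ℂ E]
    [NormedAddCommGroup F] [InnerProductSpace ℂ F] [NormedAddCommGroup K] [InnerProductSpace ℂ K]
    (T : F →ₗ.[ℂ] K) (U : E →ₗ[ℂ] F) : E →ₗ.[ℂ] K where
  domain := T.domain.comap U
  toFun := T.toFun ∘ₗ (U.restrict fun _ hf => hf)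

end DirectSum

/-! ### The Sobolev space `W^{2,2}` on an interval -/

/-- The complex Hilbert space `L²(J)`. -/
abbrev L2 (J : Set ℝ) : Type := Lp ℂ 2 (volume.restrict J)

/-- An interval of positive length. -/
structure IsInterval (J : Set ℝ) : Prop where
  convex : Convex ℝ J
  interior_nonempty : (interior J).Nonempty

/-- `u` is locally absolutely continuous on the interval `J`. -/
def IsACLoc (J : Set ℝ) (u : ℝ → ℂ) : Prop :=
  ∀ s ∈ J, ∀ t ∈ J, AbsolutelyContinuousOnInterval u s t

/-- `f ∈ W^{2,2}(J)` with continuously differentiable representative `u`, and `v = f'`, `w = f''`: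
both `u` and its derivative `v` are locally absolutely continuous on `J`, and the almost everywhere
existing derivative `w` of `v` belongs to `L²(J)`. -/
structure IsRep (J : Set ℝ) (f : L2 J) (u v : ℝ → ℂ) (w : L2 J) : Prop where
  ae_eq : f =ᵐ[volume.restrict J] u
  ac : IsACLoc J u
  hasDeriv : ∀ t ∈ J, HasDerivWithinAt u (v t) J t
  ac_deriv : IsACLoc J v
  hasDeriv_deriv : ∀ᵐ t ∂volume.restrict J, HasDerivWithinAt v (w t) J t

theorem IsRep.zero (J : Set ℝ) : IsRep J 0 0 0 0 where
  ae_eq := Lp.coeFn_zero _ _ _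
  ac := fun s _ t _ => (LipschitzWith.const (0 : ℂ)).lipschitzOnWith.absolutelyContinuousOnInterval
  hasDeriv := fun t _ => hasDerivWithinAt_const _ _ _
  ac_deriv := fun s _ t _ =>
    (LipschitzWith.const (0 : ℂ)).lipschitzOnWith.absolutelyContinuousOnInterval
  hasDeriv_deriv := by
    filter_upwards [Lp.coeFn_zero ℂ 2 (volume.restrict J)] with t ht
    rw [ht]
    exact hasDerivWithinAt_const _ _ _

theorem IsRep.add {J : Set ℝ} {f f' : L2 J} {u v u' v' : ℝ → ℂ} {w w' : L2 J}
    (h : IsRep J f u v w) (h' : IsRep J f' u' v' w') :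
    IsRep J (f + f') (u + u') (v + v') (w + w') where
  ae_eq := (Lp.coeFn_add f f').trans (h.ae_eq.add h'.ae_eq)
  ac := fun s hs t ht => (h.ac s hs t ht).add (h'.ac s hs t ht)
  hasDeriv := fun t ht => (h.hasDeriv t ht).add (h'.hasDeriv t ht)
  ac_deriv := fun s hs t ht => (h.ac_deriv s hs t ht).add (h'.ac_deriv s hs t ht)
  hasDeriv_deriv := by
    filter_upwards [Lp.coeFn_add w w', h.hasDeriv_deriv, h'.hasDeriv_deriv] with t ht h1 h2
    rw [ht]
    exact h1.add h2

theorem IsRep.smul {J : Set ℝ} {f : L2 J} {u v : ℝ → ℂ} {w : L2 J} (c : ℂ)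
    (h : IsRep J f u v w) : IsRep J (c • f) (c • u) (c • v) (c • w) where
  ae_eq := (Lp.coeFn_smul c f).trans (h.ae_eq.const_smul c)
  ac := fun s hs t ht => (h.ac s hs t ht).const_smul c
  hasDeriv := fun t ht => (h.hasDeriv t ht).const_smul c
  ac_deriv := fun s hs t ht => (h.ac_deriv s hs t ht).const_smul c
  hasDeriv_deriv := by
    filter_upwards [Lp.coeFn_smul c w, h.hasDeriv_deriv] with t ht h1
    rw [ht]
    exact h1.const_smul c

theorem IsRep.unique {J : Set ℝ} (hJ : IsInterval J) {f : L2 J} {u v u' v' : ℝ → ℂ} {w w' : L2 J}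
    (h : IsRep J f u v w) (h' : IsRep J f u' v' w') :
    EqOn u u' J ∧ EqOn v v' J ∧ w = w' := by
  have hud : UniqueDiffOn ℝ J := uniqueDiffOn_convex hJ.convex hJ.interior_nonempty
  have hcl : J ⊆ closure (interior J) := by
    rw [hJ.convex.closure_interior_eq_closure_of_nonempty_interior hJ.interior_nonempty]
    exact subset_closure
  have hu : EqOn u u' J :=
    Measure.eqOn_of_ae_eq (h.ae_eq.symm.trans h'.ae_eq)
      (fun t ht => (h.hasDeriv t ht).continuousWithinAt)
      (fun t ht => (h'.hasDeriv t ht).continuousWithinAt) hcl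
  have hv : EqOn v v' J := fun t ht =>
    (hud t ht).eq_deriv _ (h.hasDeriv t ht) ((h'.hasDeriv t ht).congr hu (hu ht))
  have hJm : NullMeasurableSet J volume := hJ.convex.nullMeasurableSet volume
  refine ⟨hu, hv, Lp.ext ?_⟩
  filter_upwards [h.hasDeriv_deriv, h'.hasDeriv_deriv, ae_restrict_mem₀ hJm] with t h1 h2 ht
  exact (hud t ht).eq_deriv _ h1 (h2.congr hv (hv ht))

/-- The Sobolev space `W^{2,2}(J)`. -/
def W22 (J : Set ℝ) : Submodule ℂ (L2 J) where
  carrier := {f | ∃ u v w, IsRep J f u v w}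
  zero_mem' := ⟨_, _, _, IsRep.zero J⟩
  add_mem' := by
    rintro f g ⟨u, v, w, h⟩ ⟨u', v', w', h'⟩
    exact ⟨_, _, _, h.add h'⟩
  smul_mem' := by
    rintro c f ⟨u, v, w, h⟩
    exact ⟨_, _, _, h.smul c⟩

/-- The subspace of those `f ∈ W^{2,2}(J)` with `f(t) = f'(t) = 0` for all `t ∈ X`. -/
def W22Zero (J X : Set ℝ) : Submodule ℂ (L2 J) where
  carrier := {f | ∃ u v w, IsRep J f u v w ∧ ∀ t ∈ X, u t = 0 ∧ v t = 0}
  zero_mem' := ⟨_, _, _, IsRep.zero J, fun _ _ => ⟨rfl, rfl⟩⟩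
  add_mem' := by
    rintro f g ⟨u, v, w, h, h0⟩ ⟨u', v', w', h', h0'⟩
    exact ⟨_, _, _, h.add h', fun t ht => by simp [h0 t ht, h0' t ht]⟩
  smul_mem' := by
    rintro c f ⟨u, v, w, h, h0⟩
    exact ⟨_, _, _, h.smul c, fun t ht => by simp [h0 t ht]⟩

/-- The continuously differentiable representative of `f ∈ W^{2,2}(J)`. On `J` it is unique, and its
values at the end points of `J` that belong to `J` are the one-sided limits of `f` there. -/
def rep {J : Set ℝ} (f : W22 J) : ℝ → ℂ := f.2.choose

/-- The first derivative of `f ∈ W^{2,2}(J)`, as a function that is continuous on `J`. -/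
def repDeriv {J : Set ℝ} (f : W22 J) : ℝ → ℂ := f.2.choose_spec.choose

/-- The second derivative of `f ∈ W^{2,2}(J)`. -/
def secondDeriv {J : Set ℝ} (f : W22 J) : L2 J := f.2.choose_spec.choose_spec.choose

theorem isRep {J : Set ℝ} (f : W22 J) : IsRep J f (rep f) (repDeriv f) (secondDeriv f) :=
  f.2.choose_spec.choose_spec.choose_spec

theorem rep_add {J : Set ℝ} (hJ : IsInterval J) (f g : W22 J) {t : ℝ} (ht : t ∈ J) :
    rep (f + g) t = rep f t + rep g t :=
  ((isRep (f + g)).unique hJ ((isRep f).add (isRep g))).1 ht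

theorem rep_smul {J : Set ℝ} (hJ : IsInterval J) (c : ℂ) (f : W22 J) {t : ℝ} (ht : t ∈ J) :
    rep (c • f) t = c * rep f t :=
  ((isRep (c • f)).unique hJ ((isRep f).smul c)).1 ht

theorem repDeriv_add {J : Set ℝ} (hJ : IsInterval J) (f g : W22 J) {t : ℝ} (ht : t ∈ J) :
    repDeriv (f + g) t = repDeriv f t + repDeriv g t :=
  ((isRep (f + g)).unique hJ ((isRep f).add (isRep g))).2.1 ht

theorem repDeriv_smul {J : Set ℝ} (hJ : IsInterval J) (c : ℂ) (f : W22 J) {t : ℝ} (ht : t ∈ J) :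
    repDeriv (c • f) t = c * repDeriv f t :=
  ((isRep (c • f)).unique hJ ((isRep f).smul c)).2.1 ht

/-- The operator `-d²/dx²` in `L²(J)` with domain `W^{2,2}(J)`. -/
def negSecondDeriv {J : Set ℝ} (hJ : IsInterval J) : L2 J →ₗ.[ℂ] L2 J where
  domain := W22 J
  toFun :=
    { toFun := fun f => -secondDeriv f
      map_add' := fun f g => by
        have := ((isRep (f + g)).unique hJ ((isRep f).add (isRep g))).2.2
        rw [this, neg_add]
      map_smul' := fun c f => by
        have := ((isRep (c • f)).unique hJ ((isRep f).smul c)).2.2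
        rw [this, RingHom.id_apply, smul_neg] }

/-- The operator `-d²/dx²` in `L²(J)` with domain
`{f ∈ W^{2,2}(J) | f(t) = f'(t) = 0 for all t ∈ X}`. -/
def minimalOperator {J : Set ℝ} (hJ : IsInterval J) (X : Set ℝ) : L2 J →ₗ.[ℂ] L2 J :=
  (negSecondDeriv hJ).domRestrict (W22Zero J X)

theorem isInterval_Icc {a b : ℝ} (hab : a < b) : IsInterval (Icc a b) where
  convex := convex_Icc a b
  interior_nonempty := by rw [interior_Icc]; exact nonempty_Ioo.2 hab

/-- The minimal operator `-d²/dx²` in `L²[a, b]`, with domain `W^{2,2}_0[a, b]`. -/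
def intervalOperator {a b : ℝ} (hab : a < b) : L2 (Icc a b) →ₗ.[ℂ] L2 (Icc a b) :=
  minimalOperator (isInterval_Icc hab) {a, b}

/-! ### The regularized boundary maps on `[a, b]`, with `d = b - a` -/

/-- First triplet: `Γ₀ f = (d^{1/2} f(a+), -d^{1/2} f(b-))`. -/
def gammaZeroA {a b : ℝ} (hab : a < b) : L2 (Icc a b) →ₗ.[ℂ] EuclideanSpace ℂ (Fin 2) where
  domain := W22 (Icc a b)
  toFun :=
    { toFun := fun f =>
        !₂[(((b - a) ^ (1 / 2 : ℝ) : ℝ) : ℂ) * rep f a,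
          -(((b - a) ^ (1 / 2 : ℝ) : ℝ) : ℂ) * rep f b]
      map_add' := fun f g => by
        have hJ := isInterval_Icc hab
        have ha := left_mem_Icc.2 hab.le
        have hb := right_mem_Icc.2 hab.le
        ext i
        fin_cases i <;> simp [rep_add hJ, ha, hb] <;> ring
      map_smul' := fun c f => by
        have hJ := isInterval_Icc hab
        have ha := left_mem_Icc.2 hab.le
        have hb := right_mem_Icc.2 hab.le
        ext i
        fin_cases i <;> simp [rep_smul hJ, ha, hb] <;> ring }

/-- First triplet: `Γ₁ f` has the components `(d f'(a+) + (f(a+) - f(b-))) / d^{3/2}` and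
`(d f'(b-) + (f(a+) - f(b-))) / d^{3/2}`. -/
def gammaOneA {a b : ℝ} (hab : a < b) : L2 (Icc a b) →ₗ.[ℂ] EuclideanSpace ℂ (Fin 2) where
  domain := W22 (Icc a b)
  toFun :=
    { toFun := fun f =>
        !₂[(((b - a : ℝ) : ℂ) * repDeriv f a + (rep f a - rep f b)) / (((b - a) ^ (3 / 2 : ℝ) : ℝ) : ℂ),
          (((b - a : ℝ) : ℂ) * repDeriv f b + (rep f a - rep f b)) / (((b - a) ^ (3 / 2 : ℝ) : ℝ) : ℂ)]
      map_add' := fun f g => by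
        have hJ := isInterval_Icc hab
        have ha := left_mem_Icc.2 hab.le
        have hb := right_mem_Icc.2 hab.le
        ext i
        fin_cases i <;> simp [rep_add hJ, repDeriv_add hJ, ha, hb] <;> ring
      map_smul' := fun c f => by
        have hJ := isInterval_Icc hab
        have ha := left_mem_Icc.2 hab.le
        have hb := right_mem_Icc.2 hab.le
        ext i
        fin_cases i <;> simp [rep_smul hJ, repDeriv_smul hJ, ha, hb] <;> ring }

/-- Second triplet: `Γ₀ f = (d^{1/2} f(a+), d^{3/2} f'(b-))`. -/
def gammaZeroB {a b : ℝ} (hab : a < b) : L2 (Icc a b) →ₗ.[ℂ] EuclideanSpace ℂ (Fin 2) where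
  domain := W22 (Icc a b)
  toFun :=
    { toFun := fun f =>
        !₂[(((b - a) ^ (1 / 2 : ℝ) : ℝ) : ℂ) * rep f a,
          (((b - a) ^ (3 / 2 : ℝ) : ℝ) : ℂ) * repDeriv f b]
      map_add' := fun f g => by
        have hJ := isInterval_Icc hab
        have ha := left_mem_Icc.2 hab.le
        have hb := right_mem_Icc.2 hab.le
        ext i
        fin_cases i <;> simp [rep_add hJ, repDeriv_add hJ, ha, hb] <;> ring
      map_smul' := fun c f => by
        have hJ := isInterval_Icc hab
        have ha := left_mem_Icc.2 hab.le
        have hb := right_mem_Icc.2 hab.le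
        ext i
        fin_cases i <;> simp [rep_smul hJ, repDeriv_smul hJ, ha, hb] <;> ring }

/-- Second triplet: `Γ₁ f` has the components `(f'(a+) - f'(b-)) / d^{1/2}` and
`(f(b-) - f(a+) - d f'(b-)) / d^{3/2}`. -/
def gammaOneB {a b : ℝ} (hab : a < b) : L2 (Icc a b) →ₗ.[ℂ] EuclideanSpace ℂ (Fin 2) where
  domain := W22 (Icc a b)
  toFun :=
    { toFun := fun f =>
        !₂[(repDeriv f a - repDeriv f b) / (((b - a) ^ (1 / 2 : ℝ) : ℝ) : ℂ),
          (rep f b - rep f a - ((b - a : ℝ) : ℂ) * repDeriv f b) / (((b - a) ^ (3 / 2 : ℝ) : ℝ) : ℂ)]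
      map_add' := fun f g => by
        have hJ := isInterval_Icc hab
        have ha := left_mem_Icc.2 hab.le
        have hb := right_mem_Icc.2 hab.le
        ext i
        fin_cases i <;> simp [rep_add hJ, repDeriv_add hJ, ha, hb] <;> ring
      map_smul' := fun c f => by
        have hJ := isInterval_Icc hab
        have ha := left_mem_Icc.2 hab.le
        have hb := right_mem_Icc.2 hab.le
        ext i
        fin_cases i <;> simp [rep_smul hJ, repDeriv_smul hJ, ha, hb] <;> ring }

/-! ### The half-open interval `[0, b)` and its partition -/

/-- The interval `[0, b)`, where `b = +∞` is allowed. -/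
def halfOpen (b : EReal) : Set ℝ := {t | 0 ≤ t ∧ (t : EReal) < b}

/-- `0 = x₀ < x₁ < x₂ < ⋯ < b` and `xₙ → b ≤ +∞`. -/
structure IsPartition (b : EReal) (x : ℕ → ℝ) : Prop where
  zero : x 0 = 0
  strictMono : StrictMono x
  tendsto : Tendsto (fun n => (x n : EReal)) atTop (𝓝 b)

namespace IsPartition

variable {b : EReal} {x : ℕ → ℝ}

/-- The `n`-th cell `[xₙ, xₙ₊₁]`. -/
abbrev cell (x : ℕ → ℝ) (n : ℕ) : Set ℝ := Icc (x n) (x (n + 1))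

theorem lt (hx : IsPartition b x) (n : ℕ) : (x n : EReal) < b := by
  have h1 : Monotone fun n => (x n : EReal) :=
    fun i j hij => EReal.coe_le_coe_iff.2 (hx.strictMono.monotone hij)
  exact lt_of_lt_of_le (EReal.coe_lt_coe_iff.2 (hx.strictMono (Nat.lt_succ_self n)))
    (h1.ge_of_tendsto hx.tendsto (n + 1))

theorem step (hx : IsPartition b x) (n : ℕ) : x n < x (n + 1) := hx.strictMono (Nat.lt_succ_self n)

theorem iUnion_cell (hx : IsPartition b x) : ⋃ n, cell x n = halfOpen b := by
  ext t
  simp only [mem_iUnion, mem_Icc, halfOpen]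
  constructor
  · rintro ⟨n, h1, h2⟩
    refine ⟨?_, lt_of_le_of_lt (EReal.coe_le_coe_iff.2 h2) (hx.lt (n + 1))⟩
    rw [← hx.zero]
    exact (hx.strictMono.monotone (Nat.zero_le n)).trans h1
  · rintro ⟨h0, hb⟩
    have hex : ∃ n, t < x n := by
      obtain ⟨n, hn⟩ := (hx.tendsto.eventually (lt_mem_nhds hb)).exists
      exact ⟨n, EReal.coe_lt_coe_iff.1 hn⟩
    classical
    obtain ⟨n, hn⟩ : ∃ n, Nat.find hex = n + 1 := by
      refine Nat.exists_eq_succ_of_ne_zero fun h => ?_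
      have := Nat.find_spec hex
      rw [h, hx.zero] at this
      exact absurd h0 (not_le.2 this)
    refine ⟨n, ?_, ?_⟩
    · exact not_lt.1 (Nat.find_min hex (by omega))
    · rw [← hn]; exact (Nat.find_spec hex).le

theorem cell_subset (hx : IsPartition b x) (n : ℕ) : cell x n ⊆ halfOpen b := by
  rw [← hx.iUnion_cell]; exact subset_iUnion (cell x) n

theorem aedisjoint (hx : IsPartition b x) : Pairwise (Function.onFun (AEDisjoint volume) (cell x)) := by
  have key : ∀ i j, i < j → AEDisjoint volume (cell x i) (cell x j) := by
    intro i j hij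
    refine measure_mono_null (t := {x (i + 1)}) ?_ (by simp)
    rintro t ⟨h1, h2⟩
    have : x (i + 1) ≤ x j := hx.strictMono.monotone hij
    exact le_antisymm h1.2 (this.trans h2.1)
  intro i j hij
  rcases lt_or_gt_of_ne hij with h | h
  · exact key i j h
  · exact (key j i h).symm

theorem restrict_eq_sum (hx : IsPartition b x) :
    (volume : Measure ℝ).restrict (halfOpen b) =
      Measure.sum fun n => volume.restrict (cell x n) := by
  rw [← hx.iUnion_cell]
  exact Measure.restrict_iUnion_ae hx.aedisjoint fun _ => measurableSet_Icc.nullMeasurableSet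

theorem isInterval (hx : IsPartition b x) : IsInterval (halfOpen b) where
  convex := by
    refine OrdConnected.convex ⟨?_⟩
    rintro s ⟨h1, _⟩ t ⟨_, h2⟩ r ⟨h3, h4⟩
    exact ⟨h1.trans h3, lt_of_le_of_lt (EReal.coe_le_coe_iff.2 h4) h2⟩
  interior_nonempty :=
    (isInterval_Icc (hx.step 0)).interior_nonempty.mono (interior_mono (hx.cell_subset 0))

/-- Restriction of functions from `[0, b)` to the `n`-th cell. -/
def restrictCell (hx : IsPartition b x) (n : ℕ) : L2 (halfOpen b) →ₗ[ℂ] L2 (cell x n) where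
  toFun f := ((Lp.memLp f).mono_measure (Measure.restrict_mono (hx.cell_subset n) le_rfl)).toLp f
  map_add' f g := by
    rw [← MemLp.toLp_add, MemLp.toLp_eq_toLp_iff]
    exact ae_restrict_of_ae_restrict_of_subset (hx.cell_subset n) (Lp.coeFn_add f g)
  map_smul' c f := by
    rw [RingHom.id_apply, ← MemLp.toLp_const_smul, MemLp.toLp_eq_toLp_iff]
    exact ae_restrict_of_ae_restrict_of_subset (hx.cell_subset n) (Lp.coeFn_smul c f)

theorem restrictCell_ae (hx : IsPartition b x) (n : ℕ) (f : L2 (halfOpen b)) :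
    hx.restrictCell n f =ᵐ[volume.restrict (cell x n)] f :=
  MemLp.coeFn_toLp
    ((Lp.memLp f).mono_measure (Measure.restrict_mono (hx.cell_subset n) le_rfl))

theorem lintegral_eq_tsum (hx : IsPartition b x) (g : ℝ → ENNReal) :
    ∫⁻ t in halfOpen b, g t = ∑' n, ∫⁻ t in cell x n, g t := by
  rw [hx.restrict_eq_sum, lintegral_sum_measure]

theorem enorm_sq {J : Set ℝ} (f : L2 J) : ‖f‖ₑ ^ 2 = ∫⁻ t in J, ‖f t‖ₑ ^ 2 := by
  have := eLpNorm_nnreal_pow_eq_lintegral (μ := volume.restrict J) (f := (f : ℝ → ℂ)) (p := 2)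
    two_ne_zero
  rw [Lp.enorm_def]
  simpa using this

theorem enorm_sq_eq_tsum (hx : IsPartition b x) (f : L2 (halfOpen b)) :
    ‖f‖ₑ ^ 2 = ∑' n, ‖hx.restrictCell n f‖ₑ ^ 2 := by
  rw [enorm_sq, hx.lintegral_eq_tsum]
  refine tsum_congr fun n => ?_
  rw [enorm_sq]
  refine lintegral_congr_ae ?_
  filter_upwards [hx.restrictCell_ae n f] with t ht
  rw [ht]

theorem hasSum_norm_sq (hx : IsPartition b x) (f : L2 (halfOpen b)) :
    HasSum (fun n => ‖hx.restrictCell n f‖ ^ 2) (‖f‖ ^ 2) := by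
  have h := hx.enorm_sq_eq_tsum f
  have hne : ∑' n, ‖hx.restrictCell n f‖ₑ ^ 2 ≠ ⊤ := by
    rw [← h]; exact ENNReal.pow_ne_top enorm_ne_top
  have h1 := ENNReal.hasSum_toReal hne
  rw [← ENNReal.tsum_toReal_eq (fun n => ENNReal.pow_ne_top enorm_ne_top), ← h] at h1
  simpa using h1

/-- The identification of `L²[0, b)` with the Hilbert direct sum of the spaces `L²[xₙ, xₙ₊₁]`,
as a linear isometry: `f` is sent to the sequence of its restrictions. -/
def decompIsometry (hx : IsPartition b x) :
    L2 (halfOpen b) →ₗᵢ[ℂ] lp (fun n => L2 (cell x n)) 2 where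
  toFun f := ⟨fun n => hx.restrictCell n f, memℓp_gen (by
    simpa using (hx.hasSum_norm_sq f).summable)⟩
  map_add' f g := by
    ext n : 2
    exact map_add (hx.restrictCell n) f g
  map_smul' c f := by
    ext n : 2
    exact map_smul (hx.restrictCell n) c f
  norm_map' f := by
    refine (sq_eq_sq₀ (norm_nonneg _) (norm_nonneg _)).1 ?_
    have h := lp.norm_rpow_eq_tsum (p := 2) (by norm_num)
      (⟨fun n => hx.restrictCell n f, memℓp_gen (by
        simpa using (hx.hasSum_norm_sq f).summable)⟩ : lp (fun n => L2 (cell x n)) 2)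
    have h2 := (hx.hasSum_norm_sq f).tsum_eq
    simp only [ENNReal.toReal_ofNat, Real.rpow_ofNat] at h
    exact h.trans h2

theorem decompIsometry_surjective (hx : IsPartition b x) :
    Function.Surjective hx.decompIsometry := by
  intro g
  classical
  let F : ℝ → ℂ := fun t =>
    if h : ∃ n, t ∈ Ico (x n) (x (n + 1)) then (g h.choose : ℝ → ℂ) t else 0
  have hF : ∀ n, F =ᵐ[volume.restrict (cell x n)] g n := by
    intro n
    have h1 : ∀ᵐ t ∂volume.restrict (cell x n), t ∈ Ico (x n) (x (n + 1)) := by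
      rw [cell, ← restrict_Ico_eq_restrict_Icc]
      exact ae_restrict_mem measurableSet_Ico
    filter_upwards [h1] with t ht
    have hex : ∃ n, t ∈ Ico (x n) (x (n + 1)) := ⟨n, ht⟩
    have hn : hex.choose = n := by
      have hc := hex.choose_spec
      rcases lt_trichotomy hex.choose n with h | h | h
      · exact absurd (hc.2.trans_le (hx.strictMono.monotone (Nat.succ_le_of_lt h)))
          (not_lt.2 ht.1)
      · exact h
      · exact absurd (ht.2.trans_le (hx.strictMono.monotone (Nat.succ_le_of_lt h)))
          (not_lt.2 hc.1)
    have hFt : F t = (g hex.choose : ℝ → ℂ) t := dif_pos hex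
    rw [hFt, hn]
  have hmeas : AEStronglyMeasurable F (volume.restrict (halfOpen b)) := by
    rw [← hx.iUnion_cell, aestronglyMeasurable_iUnion_iff]
    exact fun n => (Lp.aestronglyMeasurable (g n)).congr (hF n).symm
  have hsum : ∫⁻ t in halfOpen b, ‖F t‖ₑ ^ 2 < ⊤ := by
    have h1 : ∫⁻ t in halfOpen b, ‖F t‖ₑ ^ 2 = ∑' n, ENNReal.ofReal (‖g n‖ ^ 2) := by
      rw [hx.lintegral_eq_tsum]
      refine tsum_congr fun n => ?_
      rw [ENNReal.ofReal_pow (norm_nonneg _), ofReal_norm, enorm_sq]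
      refine lintegral_congr_ae ?_
      filter_upwards [hF n] with t ht
      rw [ht]
    have h2 : Summable fun n => ‖g n‖ ^ 2 := by
      simpa using (lp.memℓp g).summable (by norm_num)
    rw [h1, ← ENNReal.ofReal_tsum_of_nonneg (fun n => by positivity) h2]
    exact ENNReal.ofReal_lt_top
  have hmem : MemLp F 2 (volume.restrict (halfOpen b)) := by
    refine ⟨hmeas, ?_⟩
    have := eLpNorm_nnreal_pow_eq_lintegral (μ := volume.restrict (halfOpen b)) (f := F) (p := 2)
      two_ne_zero
    have h2 : eLpNorm F 2 (volume.restrict (halfOpen b)) ^ 2 < ⊤ := by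
      have h3 : eLpNorm F 2 (volume.restrict (halfOpen b)) ^ 2 =
          ∫⁻ t in halfOpen b, ‖F t‖ₑ ^ 2 := by simpa using this
      rw [h3]; exact hsum
    exact (ENNReal.pow_lt_top_iff.1 h2).resolve_right two_ne_zero
  refine ⟨hmem.toLp F, ?_⟩
  ext n : 2
  refine Lp.ext ?_
  refine (hx.restrictCell_ae n _).trans (EventuallyEq.trans ?_ (hF n))
  exact ae_restrict_of_ae_restrict_of_subset (hx.cell_subset n) hmem.coeFn_toLp

/-- The unitary identification of `L²[0, b)` with the Hilbert direct sum of the `L²[xₙ, xₙ₊₁]`;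
it sends `f` to the sequence of the restrictions of `f`. -/
def decomp (hx : IsPartition b x) :
    L2 (halfOpen b) ≃ₗᵢ[ℂ] lp (fun n => L2 (cell x n)) 2 :=
  LinearIsometryEquiv.ofSurjective hx.decompIsometry hx.decompIsometry_surjective

/-- The minimal operator `H_min = -d²/dx²` in `L²[0, b)`, with domain the set of all
`f ∈ W^{2,2}[0, b)` such that `f(xₙ) = f'(xₙ) = 0` for all `n ≥ 0`. -/
def Hmin (hx : IsPartition b x) : L2 (halfOpen b) →ₗ.[ℂ] L2 (halfOpen b) :=
  minimalOperator hx.isInterval (range x)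

/-- The minimal operator `Hₙ = -d²/dx²` in `L²[xₙ, xₙ₊₁]`, with domain `W^{2,2}_0[xₙ, xₙ₊₁]`. -/
def cellOperator (hx : IsPartition b x) (n : ℕ) : L2 (cell x n) →ₗ.[ℂ] L2 (cell x n) :=
  intervalOperator (hx.step n)

/-- The direct sum `⊕ₙ Γₙ` of boundary maps on the cells, as a map from `L²[0, b)`, with domain
`{f ∈ dom H_min† | ∑ ‖Γₙ fₙ‖² < ∞}`, where `fₙ` is the restriction of `f` to the `n`-th cell. -/
def boundarySum (hx : IsPartition b x)
    (Γ : ∀ n, L2 (cell x n) →ₗ.[ℂ] EuclideanSpace ℂ (Fin 2)) :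
    L2 (halfOpen b) →ₗ.[ℂ] lp (fun _ : ℕ => EuclideanSpace ℂ (Fin 2)) 2 :=
  (pullback (directSum Γ) hx.decomp.toLinearEquiv.toLinearMap).domRestrict hx.Hmin.adjoint.domain

end IsPartition

end BoundaryTriplets

end

open BoundaryTriplets

/-!
By the Green identity, the range of the minimal operator on a bounded interval is the orthogonal
complement of the affine functions, the solutions of `-f'' = 0`. Hence its adjoint `H†` has domain
`W^{2,2}`, and `H††` is again the minimal operator because the boundary values of elements of
`dom H†` are arbitrary.

For a family of boundary triplets, everything survives the passage to the direct sum except the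
convergence of the boundary data. Suppose the pairs of boundary maps have right inverses that are
bounded by `C` in the graph norm, uniformly over the family. Pairing `f` with an element `g` such
that `Γ₀ g = Γ₁ f` and `Γ₁ g = -Γ₀ f`, the Green identity reads
`‖Γ₀ f‖² + ‖Γ₁ f‖² = (g, H† f) - (H† g, f)`, and Cauchy-Schwarz bounds `‖Γ₀ f‖² + ‖Γ₁ f‖²` by `C`
times the squared graph norm of `f`. So uniformly bounded right inverses already make the boundary
maps uniformly bounded, and the direct sum of the triplets is a boundary triplet.

On an interval of length `d` the right inverse is given by cubic Hermite interpolation. The powers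
of `d` in the regularized boundary maps are exactly those for which the norms of the interpolant and
of its second derivative stay bounded as `d → 0`.
-/

namespace BoundaryTriplets

section Graph

theorem mem_graph_domRestrict {R E F : Type*} [Ring R] [AddCommGroup E] [Module R E]
    [AddCommGroup F] [Module R F] {T : E →ₗ.[R] F} {S : Submodule R E} {f : E} {g : F} :
    (f, g) ∈ (T.domRestrict S).graph ↔ f ∈ S ∧ (f, g) ∈ T.graph := by
  simp only [LinearPMap.mem_graph_iff]
  constructor
  · rintro ⟨y, rfl, rfl⟩
    exact ⟨y.2.1, ⟨y, y.2.2⟩, rfl, (LinearPMap.domRestrict_apply rfl).symm⟩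
  · rintro ⟨hS, y, rfl, rfl⟩
    exact ⟨⟨y, hS, y.2⟩, rfl, LinearPMap.domRestrict_apply rfl⟩

theorem mem_graph_compPMap {R E F K : Type*} [Ring R] [AddCommGroup E] [Module R E]
    [AddCommGroup F] [Module R F] [AddCommGroup K] [Module R K] {T : E →ₗ.[R] F} {U : F ≃ₗ[R] K}
    {f : E} {k : K} : (f, k) ∈ (U.toLinearMap.compPMap T).graph ↔ (f, U.symm k) ∈ T.graph := by
  simp only [LinearPMap.mem_graph_iff]
  exact exists_congr fun y => and_congr_right fun _ => U.eq_symm_apply.symm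

theorem mem_graph_pullback {E F K : Type*} [NormedAddCommGroup E] [InnerProductSpace ℂ E]
    [NormedAddCommGroup F] [InnerProductSpace ℂ F] [NormedAddCommGroup K] [InnerProductSpace ℂ K]
    {T : F →ₗ.[ℂ] K} {U : E →ₗ[ℂ] F} {f : E} {k : K} :
    (f, k) ∈ (pullback T U).graph ↔ (U f, k) ∈ T.graph := by
  simp only [LinearPMap.mem_graph_iff]
  constructor
  · rintro ⟨y, rfl, rfl⟩
    exact ⟨⟨U y, y.2⟩, rfl, rfl⟩
  · rintro ⟨y, hy, rfl⟩
    obtain ⟨_, hUf⟩ := y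
    subst hy
    exact ⟨⟨f, hUf⟩, rfl, rfl⟩

theorem mem_graph_directSum {G G' : ℕ → Type*} [∀ n, NormedAddCommGroup (G n)]
    [∀ n, InnerProductSpace ℂ (G n)] [∀ n, NormedAddCommGroup (G' n)]
    [∀ n, InnerProductSpace ℂ (G' n)] {S : ∀ n, G n →ₗ.[ℂ] G' n} {f : lp G 2} {g : lp G' 2} :
    (f, g) ∈ (directSum S).graph ↔ ∀ n, (f n, g n) ∈ (S n).graph := by
  constructor
  · intro h n
    obtain ⟨y, rfl, rfl⟩ := (LinearPMap.mem_graph_iff _).1 h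
    exact (S n).mem_graph ⟨(y : lp G 2) n, y.2.choose n⟩
  · intro h
    have hdom : ∀ n, f n ∈ (S n).domain := fun n => LinearPMap.mem_domain_of_mem_graph (h n)
    have hval : ∀ n, S n ⟨f n, hdom n⟩ = g n := fun n =>
      ((LinearPMap.image_iff (hdom n)).2 (h n)).symm
    have hmem : Memℓp (fun n => S n ⟨f n, hdom n⟩) 2 := by
      simp only [hval]
      exact lp.memℓp g
    refine (LinearPMap.mem_graph_iff _).2 ⟨⟨f, hdom, hmem⟩, rfl, ?_⟩
    ext n : 2
    exact hval n

end Graph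

section Adjoint

variable {𝕜 E F : Type*} [RCLike 𝕜] [NormedAddCommGroup E] [InnerProductSpace 𝕜 E]
  [CompleteSpace E] [NormedAddCommGroup F] [InnerProductSpace 𝕜 F]

theorem mem_graph_adjoint {T : E →ₗ.[𝕜] F} (hT : Dense (T.domain : Set E)) {f : F} {g : E} :
    (f, g) ∈ T.adjoint.graph ↔ ∀ p q, (p, q) ∈ T.graph → inner 𝕜 q f = inner 𝕜 p g := by
  rw [LinearPMap.adjoint_graph_eq_graph_adjoint hT, Submodule.mem_adjoint_iff]
  simp only [sub_eq_zero]

theorem isClosed_of_adjoint_adjoint_le {A : E →ₗ.[𝕜] E} (hA : Dense (A.domain : Set E))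
    (hsymm : A ≤ A.adjoint) (h : A.adjoint.adjoint ≤ A) : A.IsClosed := by
  have hA' : Dense (A.adjoint.domain : Set E) := hA.mono hsymm.1
  have hle : A ≤ A.adjoint.adjoint := LinearPMap.le_of_le_graph fun ⟨f, f'⟩ hf =>
    (mem_graph_adjoint hA').2 fun p q hpq => by
      rw [← inner_conj_symm, ← (mem_graph_adjoint hA).1 hpq f f' hf, inner_conj_symm]
  rw [hle.antisymm h]
  exact LinearPMap.adjoint_isClosed hA'

end Adjoint

theorem sq_norm_inner_sub_inner_le {𝕜 V : Type*} [RCLike 𝕜] [SeminormedAddCommGroup V]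
    [InnerProductSpace 𝕜 V] (f f' g g' : V) : ‖inner 𝕜 g f' - inner 𝕜 g' f‖ ^ 2 ≤
      (‖g‖ ^ 2 + ‖g'‖ ^ 2) * (‖f‖ ^ 2 + ‖f'‖ ^ 2) := by
  have hnorm : ‖inner 𝕜 g f' - inner 𝕜 g' f‖ ≤ ‖g‖ * ‖f'‖ + ‖g'‖ * ‖f‖ :=
    (norm_sub_le _ _).trans (add_le_add (norm_inner_le_norm _ _) (norm_inner_le_norm _ _))
  refine (pow_le_pow_left₀ (norm_nonneg _) hnorm 2).trans ?_
  nlinarith [sq_nonneg (‖g‖ * ‖f‖ - ‖g'‖ * ‖f'‖)]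

section Triplet

variable {E : Type*} [NormedAddCommGroup E] [InnerProductSpace ℂ E] [CompleteSpace E]
variable {H : Type*} [NormedAddCommGroup H] [InnerProductSpace ℂ H]

/-- The abstract Green identity for `A†` and the boundary maps `Γ₀`, `Γ₁`. It is stated on graphs,
so that it does not presuppose any relation between the domains of the three maps. -/
def GreenIdentity (A : E →ₗ.[ℂ] E) (Γ₀ Γ₁ : E →ₗ.[ℂ] H) : Prop :=
  ∀ ⦃f f' g g' : E⦄ ⦃f₀ f₁ g₀ g₁ : H⦄, (f, f') ∈ A.adjoint.graph → (g, g') ∈ A.adjoint.graph →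
    (f, f₀) ∈ Γ₀.graph → (f, f₁) ∈ Γ₁.graph → (g, g₀) ∈ Γ₀.graph → (g, g₁) ∈ Γ₁.graph →
    inner ℂ g f' - inner ℂ g' f = inner ℂ g₀ f₁ - inner ℂ g₁ f₀

/-- Arbitrary boundary data `(h₀, h₁)` are attained by some `f ∈ dom A†` whose squared graph norm
is at most `C` times `‖h₀‖² + ‖h₁‖²`. A common constant `C` is what makes an infinite direct sum of
boundary triplets a boundary triplet. -/
def HasRightInverseBound (A : E →ₗ.[ℂ] E) (Γ₀ Γ₁ : E →ₗ.[ℂ] H) (C : ℝ) : Prop :=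
  ∀ h₀ h₁ : H, ∃ f f' : E, (f, f') ∈ A.adjoint.graph ∧ (f, h₀) ∈ Γ₀.graph ∧
    (f, h₁) ∈ Γ₁.graph ∧ ‖f‖ ^ 2 + ‖f'‖ ^ 2 ≤ C * (‖h₀‖ ^ 2 + ‖h₁‖ ^ 2)

variable {A : E →ₗ.[ℂ] E} {Γ₀ Γ₁ : E →ₗ.[ℂ] H} {C : ℝ}

theorem HasRightInverseBound.mono {C' : ℝ} (h : HasRightInverseBound A Γ₀ Γ₁ C) (hC : C ≤ C') :
    HasRightInverseBound A Γ₀ Γ₁ C' := fun h₀ h₁ => by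
  obtain ⟨f, f', hf, hf₀, hf₁, hbound⟩ := h h₀ h₁
  exact ⟨f, f', hf, hf₀, hf₁, hbound.trans (by gcongr)⟩

namespace GreenIdentity

/-- Pair `f` with an element `g` whose boundary data are `(f₁, -f₀)`: the right-hand side of the
Green identity becomes `‖f₀‖² + ‖f₁‖²`. -/
theorem norm_sq_add_norm_sq_le (hG : GreenIdentity A Γ₀ Γ₁)
    (hR : HasRightInverseBound A Γ₀ Γ₁ C) (hC : 0 ≤ C) {f f' : E} {f₀ f₁ : H}
    (hf : (f, f') ∈ A.adjoint.graph) (hf₀ : (f, f₀) ∈ Γ₀.graph) (hf₁ : (f, f₁) ∈ Γ₁.graph) :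
    ‖f₀‖ ^ 2 + ‖f₁‖ ^ 2 ≤ C * (‖f‖ ^ 2 + ‖f'‖ ^ 2) := by
  obtain ⟨g, g', hg, hg₀, hg₁, hbound⟩ := hR f₁ (-f₀)
  have hpair : inner ℂ g f' - inner ℂ g' f = ((‖f₀‖ ^ 2 + ‖f₁‖ ^ 2 : ℝ) : ℂ) := by
    rw [hG hf hg hf₀ hf₁ hg₀ hg₁, inner_neg_left, inner_self_eq_norm_sq_to_K,
      inner_self_eq_norm_sq_to_K]
    simp [add_comm]
  have hcs := sq_norm_inner_sub_inner_le (𝕜 := ℂ) f f' g g'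
  rw [hpair, Complex.norm_real, Real.norm_of_nonneg (by positivity)] at hcs
  rw [norm_neg, add_comm (‖f₁‖ ^ 2)] at hbound
  rcases eq_or_lt_of_le (by positivity : 0 ≤ ‖f₀‖ ^ 2 + ‖f₁‖ ^ 2) with hzero | hpos
  · rw [← hzero]
    positivity
  · refine le_of_mul_le_mul_left ?_ hpos
    calc (‖f₀‖ ^ 2 + ‖f₁‖ ^ 2) * (‖f₀‖ ^ 2 + ‖f₁‖ ^ 2)
        ≤ (‖g‖ ^ 2 + ‖g'‖ ^ 2) * (‖f‖ ^ 2 + ‖f'‖ ^ 2) := by rwa [← sq]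
      _ ≤ C * (‖f₀‖ ^ 2 + ‖f₁‖ ^ 2) * (‖f‖ ^ 2 + ‖f'‖ ^ 2) := by gcongr
      _ = (‖f₀‖ ^ 2 + ‖f₁‖ ^ 2) * (C * (‖f‖ ^ 2 + ‖f'‖ ^ 2)) := by ring

theorem isBoundaryTriplet [CompleteSpace H] (hG : GreenIdentity A Γ₀ Γ₁)
    (hR : HasRightInverseBound A Γ₀ Γ₁ C) (hC : 0 ≤ C) (hA : Dense (A.domain : Set E))
    (hclosed : A.IsClosed) (hsymm : A ≤ A.adjoint) (hdom₀ : Γ₀.domain = A.adjoint.domain)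
    (hdom₁ : Γ₁.domain = A.adjoint.domain) : IsBoundaryTriplet A Γ₀ Γ₁ := by
  have hmem₀ (f : A.adjoint.domain) := Γ₀.mem_graph ⟨f, hdom₀.ge f.2⟩
  have hmem₁ (f : A.adjoint.domain) := Γ₁.mem_graph ⟨f, hdom₁.ge f.2⟩
  have hbound (f : A.adjoint.domain) :=
    hG.norm_sq_add_norm_sq_le hR hC (A.adjoint.mem_graph f) (hmem₀ f) (hmem₁ f)
  refine ⟨hA, hclosed, hsymm, inferInstance, hdom₀, hdom₁, ⟨C, fun f => ?_⟩, ⟨C, fun f => ?_⟩,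
    fun f g => ?_, fun h₀ h₁ => ?_⟩
  · exact (le_add_of_nonneg_right (by positivity)).trans (hbound f)
  · exact (le_add_of_nonneg_left (by positivity)).trans (hbound f)
  · exact hG (A.adjoint.mem_graph f) (A.adjoint.mem_graph g) (hmem₀ f) (hmem₁ f) (hmem₀ g)
      (hmem₁ g)
  · obtain ⟨f, f', hf, hf₀, hf₁, -⟩ := hR h₀ h₁
    exact ⟨⟨f, LinearPMap.mem_domain_of_mem_graph hf⟩, ((LinearPMap.image_iff _).2 hf₀).symm,
      ((LinearPMap.image_iff _).2 hf₁).symm⟩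

end GreenIdentity

theorem IsBoundaryTriplet.greenIdentity (h : IsBoundaryTriplet A Γ₀ Γ₁) :
    GreenIdentity A Γ₀ Γ₁ := by
  intro f f' g g' f₀ f₁ g₀ g₁ hf hg hf₀ hf₁ hg₀ hg₁
  have hfd := LinearPMap.mem_domain_of_mem_graph hf
  have hgd := LinearPMap.mem_domain_of_mem_graph hg
  have hgreen := h.green ⟨f, hfd⟩ ⟨g, hgd⟩
  rwa [← (LinearPMap.image_iff hfd).2 hf, ← (LinearPMap.image_iff hgd).2 hg,
    ← (LinearPMap.image_iff (h.dom₀.ge hfd)).2 hf₀, ← (LinearPMap.image_iff (h.dom₁.ge hfd)).2 hf₁,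
    ← (LinearPMap.image_iff (h.dom₀.ge hgd)).2 hg₀,
    ← (LinearPMap.image_iff (h.dom₁.ge hgd)).2 hg₁] at hgreen

end Triplet

section DirectSumOperator

variable {G : ℕ → Type*} [∀ n, NormedAddCommGroup (G n)]

theorem hasSum_norm_sq_lp (f : lp G 2) : HasSum (fun n => ‖f n‖ ^ 2) (‖f‖ ^ 2) := by
  simpa using lp.hasSum_norm (p := 2) (by norm_num) f

theorem memℓp_two_of_norm_sq_le {f : ∀ n, G n} {c : ℕ → ℝ} (hc : Summable c)
    (hf : ∀ n, ‖f n‖ ^ 2 ≤ c n) : Memℓp f 2 :=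
  memℓp_gen (by simpa using Summable.of_nonneg_of_le (fun n => sq_nonneg ‖f n‖) hf hc)

variable [∀ n, InnerProductSpace ℂ (G n)]
variable {E : Type*} [NormedAddCommGroup E] [InnerProductSpace ℂ E]

/-- `A` is the direct sum `⊕ₙ Sₙ` under the identification `U` of its Hilbert space with the Hilbert
direct sum `⊕ₙ Gₙ`. -/
def IsDirectSumVia (U : E ≃ₗᵢ[ℂ] lp G 2) (A : E →ₗ.[ℂ] E) (S : ∀ n, G n →ₗ.[ℂ] G n) : Prop :=
  U.toLinearEquiv.toLinearMap.compPMap A = pullback (directSum S) U.toLinearEquiv.toLinearMap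

variable {U : E ≃ₗᵢ[ℂ] lp G 2} {A : E →ₗ.[ℂ] E} {S : ∀ n, G n →ₗ.[ℂ] G n}

theorem isDirectSumVia_iff : IsDirectSumVia U A S ↔
    ∀ f g, (f, g) ∈ A.graph ↔ ∀ n, (U f n, U g n) ∈ (S n).graph := by
  have hpull (f : E) (k : lp G 2) :
      (f, k) ∈ (pullback (directSum S) U.toLinearEquiv.toLinearMap).graph ↔
        ∀ n, (U f n, k n) ∈ (S n).graph := mem_graph_pullback.trans mem_graph_directSum
  constructor
  · intro h f g
    have hA := mem_graph_compPMap (T := A) (U := U.toLinearEquiv) (f := f) (k := U g)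
    rw [show U.toLinearEquiv.symm (U g) = g from U.symm_apply_apply g] at hA
    rw [← hA, h, hpull]
  · refine fun h => LinearPMap.eq_of_eq_graph (Submodule.ext fun ⟨f, k⟩ => ?_)
    rw [mem_graph_compPMap, h, hpull, show U (U.toLinearEquiv.symm k) = k from U.apply_symm_apply k]

theorem inner_symm_single (U : E ≃ₗᵢ[ℂ] lp G 2) (n : ℕ) (p : G n) (f : E) :
    inner ℂ (U.symm (lp.single 2 n p)) f = inner ℂ p (U f n) := by
  rw [← U.inner_map_map, U.apply_symm_apply, lp.inner_single_left]

namespace IsDirectSumVia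

theorem mem_graph_single (hA : IsDirectSumVia U A S) {n : ℕ} {p q : G n}
    (h : (p, q) ∈ (S n).graph) :
    (U.symm (lp.single 2 n p), U.symm (lp.single 2 n q)) ∈ A.graph := by
  rw [isDirectSumVia_iff.1 hA]
  intro m
  rw [U.apply_symm_apply, U.apply_symm_apply]
  by_cases hm : m = n
  · subst hm
    rwa [lp.single_apply_self, lp.single_apply_self]
  · rw [lp.single_apply_ne _ _ _ hm, lp.single_apply_ne _ _ _ hm]
    exact Submodule.zero_mem _

theorem isClosed (hA : IsDirectSumVia U A S) (hS : ∀ n, (S n).IsClosed) : A.IsClosed := by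
  have hgraph : (A.graph : Set (E × E)) =
      ⋂ n, (fun x : E × E => (U x.1 n, U x.2 n)) ⁻¹' ((S n).graph : Set (G n × G n)) := by
    ext ⟨f, g⟩
    simp only [SetLike.mem_coe, isDirectSumVia_iff.1 hA, mem_iInter, mem_preimage]
  have hcoord (n : ℕ) : Continuous fun f : E => U f n :=
    (lp.evalCLM ℂ G 2 n).continuous.comp U.continuous
  rw [LinearPMap.IsClosed, hgraph]
  exact isClosed_iInter fun n => (hS n).preimage
    (((hcoord n).comp continuous_fst).prodMk ((hcoord n).comp continuous_snd))

variable [CompleteSpace E]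

theorem dense_domain (hA : IsDirectSumVia U A S) (hS : ∀ n, Dense ((S n).domain : Set (G n))) :
    Dense (A.domain : Set E) := by
  rw [Submodule.dense_iff_topologicalClosure_eq_top, Submodule.topologicalClosure_eq_top_iff,
    Submodule.eq_bot_iff]
  intro f hf
  rw [← U.map_eq_zero_iff]
  ext n : 2
  refine (hS n).eq_zero_of_inner_right ℂ fun p hp => ?_
  rw [← inner_symm_single]
  exact hf _ (LinearPMap.mem_domain_of_mem_graph
    (hA.mem_graph_single ((S n).mem_graph ⟨p, hp⟩)))

variable [∀ n, CompleteSpace (G n)]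

theorem adjoint (hA : IsDirectSumVia U A S) (hS : ∀ n, Dense ((S n).domain : Set (G n))) :
    IsDirectSumVia U A.adjoint fun n => (S n).adjoint := by
  refine isDirectSumVia_iff.2 fun f g => ?_
  simp only [mem_graph_adjoint (hA.dense_domain hS), fun n => mem_graph_adjoint (hS n)]
  constructor
  · intro h n p q hpq
    have hsingle := h _ _ (hA.mem_graph_single hpq)
    rwa [inner_symm_single, inner_symm_single] at hsingle
  · intro h p q hpq
    rw [← U.inner_map_map, ← U.inner_map_map p, lp.inner_eq_tsum, lp.inner_eq_tsum]
    exact tsum_congr fun n => h n _ _ ((isDirectSumVia_iff.1 hA p q).1 hpq n)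

theorem le_adjoint (hA : IsDirectSumVia U A S) (hS : ∀ n, Dense ((S n).domain : Set (G n)))
    (hsymm : ∀ n, S n ≤ (S n).adjoint) : A ≤ A.adjoint :=
  LinearPMap.le_of_le_graph fun ⟨f, g⟩ hfg => (isDirectSumVia_iff.1 (hA.adjoint hS) f g).2 fun n =>
    LinearPMap.le_graph_of_le (hsymm n) ((isDirectSumVia_iff.1 hA f g).1 hfg n)

end IsDirectSumVia

end DirectSumOperator

section DirectSumTriplet

variable {G K : ℕ → Type*} [∀ n, NormedAddCommGroup (G n)] [∀ n, InnerProductSpace ℂ (G n)]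
variable [∀ n, NormedAddCommGroup (K n)] [∀ n, InnerProductSpace ℂ (K n)]
variable {E : Type*} [NormedAddCommGroup E] [InnerProductSpace ℂ E] [CompleteSpace E]

/-- The direct sum `⊕ₙ Γₙ` of boundary maps, transported to the Hilbert space of `A` along `U` and
restricted to `dom A†`. -/
noncomputable def boundaryMapSum (U : E ≃ₗᵢ[ℂ] lp G 2) (A : E →ₗ.[ℂ] E)
    (Γ : ∀ n, G n →ₗ.[ℂ] K n) : E →ₗ.[ℂ] lp K 2 :=
  (pullback (directSum Γ) U.toLinearEquiv.toLinearMap).domRestrict A.adjoint.domain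

variable {U : E ≃ₗᵢ[ℂ] lp G 2} {A : E →ₗ.[ℂ] E} {S : ∀ n, G n →ₗ.[ℂ] G n}

theorem mem_graph_boundaryMapSum {Γ : ∀ n, G n →ₗ.[ℂ] K n} {f : E} {h : lp K 2} :
    (f, h) ∈ (boundaryMapSum U A Γ).graph ↔
      f ∈ A.adjoint.domain ∧ ∀ n, (U f n, h n) ∈ (Γ n).graph := by
  rw [boundaryMapSum, mem_graph_domRestrict, mem_graph_pullback, mem_graph_directSum]
  rfl

theorem inner_sub_inner_lp {f f' g g' : lp G 2} {p p' q q' : lp K 2}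
    (h : ∀ n, inner ℂ (g n) (f' n) - inner ℂ (g' n) (f n) =
      inner ℂ (q n) (p' n) - inner ℂ (q' n) (p n)) :
    inner ℂ g f' - inner ℂ g' f = inner ℂ q p' - inner ℂ q' p := by
  have hG := (lp.hasSum_inner (𝕜 := ℂ) g f').sub (lp.hasSum_inner (𝕜 := ℂ) g' f)
  have hK := (lp.hasSum_inner (𝕜 := ℂ) q p').sub (lp.hasSum_inner (𝕜 := ℂ) q' p)
  simp only [h] at hG
  exact hG.unique hK

variable [∀ n, CompleteSpace (G n)] {Γ Γ₀ Γ₁ : ∀ n, G n →ₗ.[ℂ] K n} {C : ℝ}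

theorem boundaryMapSum_domain (hA : IsDirectSumVia U A.adjoint fun n => (S n).adjoint)
    (hdom : ∀ n, (Γ n).domain = (S n).adjoint.domain)
    (hbound : ∀ n f f' h, (f, f') ∈ (S n).adjoint.graph → (f, h) ∈ (Γ n).graph →
      ‖h‖ ^ 2 ≤ C * (‖f‖ ^ 2 + ‖f'‖ ^ 2)) :
    (boundaryMapSum U A Γ).domain = A.adjoint.domain := by
  refine le_antisymm (fun f hf => hf.1) fun f hf => ?_
  obtain ⟨f', hf'⟩ := LinearPMap.mem_domain_iff.1 hf
  have hcoord := (isDirectSumVia_iff.1 hA f f').1 hf'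
  choose h hh using fun n => LinearPMap.mem_domain_iff.1
    ((hdom n).ge (LinearPMap.mem_domain_of_mem_graph (hcoord n)))
  have hmem : Memℓp h 2 := memℓp_two_of_norm_sq_le
    (((hasSum_norm_sq_lp (U f)).summable.add (hasSum_norm_sq_lp (U f')).summable).mul_left C)
    fun n => hbound n _ _ _ (hcoord n) (hh n)
  exact LinearPMap.mem_domain_of_mem_graph (y := (⟨h, hmem⟩ : lp K 2))
    (mem_graph_boundaryMapSum.2 ⟨hf, hh⟩)

theorem GreenIdentity.directSum (hA : IsDirectSumVia U A.adjoint fun n => (S n).adjoint)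
    (hG : ∀ n, GreenIdentity (S n) (Γ₀ n) (Γ₁ n)) :
    GreenIdentity A (boundaryMapSum U A Γ₀) (boundaryMapSum U A Γ₁) := by
  intro f f' g g' f₀ f₁ g₀ g₁ hf hg hf₀ hf₁ hg₀ hg₁
  rw [isDirectSumVia_iff.1 hA] at hf hg
  rw [mem_graph_boundaryMapSum] at hf₀ hf₁ hg₀ hg₁
  rw [← U.inner_map_map g, ← U.inner_map_map g']
  exact inner_sub_inner_lp fun n =>
    hG n (hf n) (hg n) (hf₀.2 n) (hf₁.2 n) (hg₀.2 n) (hg₁.2 n)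

theorem HasRightInverseBound.directSum (hA : IsDirectSumVia U A.adjoint fun n => (S n).adjoint)
    (hR : ∀ n, HasRightInverseBound (S n) (Γ₀ n) (Γ₁ n) C) :
    HasRightInverseBound A (boundaryMapSum U A Γ₀) (boundaryMapSum U A Γ₁) C := by
  intro h₀ h₁
  choose f f' hf hf₀ hf₁ hbound using fun n => hR n (h₀ n) (h₁ n)
  have hsum := ((hasSum_norm_sq_lp h₀).add (hasSum_norm_sq_lp h₁)).mul_left C
  let F : lp G 2 := ⟨f, memℓp_two_of_norm_sq_le hsum.summable fun n =>
    (le_add_of_nonneg_right (sq_nonneg _)).trans (hbound n)⟩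
  let F' : lp G 2 := ⟨f', memℓp_two_of_norm_sq_le hsum.summable fun n =>
    (le_add_of_nonneg_left (sq_nonneg _)).trans (hbound n)⟩
  have hgraph : (U.symm F, U.symm F') ∈ A.adjoint.graph := by
    rw [isDirectSumVia_iff.1 hA, U.apply_symm_apply, U.apply_symm_apply]
    exact hf
  have hdom := LinearPMap.mem_domain_of_mem_graph hgraph
  refine ⟨U.symm F, U.symm F', hgraph, ?_, ?_, ?_⟩
  · rw [mem_graph_boundaryMapSum, U.apply_symm_apply]
    exact ⟨hdom, hf₀⟩
  · rw [mem_graph_boundaryMapSum, U.apply_symm_apply]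
    exact ⟨hdom, hf₁⟩
  · rw [U.symm.norm_map, U.symm.norm_map]
    exact hasSum_le hbound ((hasSum_norm_sq_lp F).add (hasSum_norm_sq_lp F')) hsum

theorem IsBoundaryTriplet.directSum (hA : IsDirectSumVia U A S) (hC : 0 ≤ C)
    (hT : ∀ n, IsBoundaryTriplet (S n) (Γ₀ n) (Γ₁ n))
    (hR : ∀ n, HasRightInverseBound (S n) (Γ₀ n) (Γ₁ n) C) :
    IsBoundaryTriplet A (boundaryMapSum U A Γ₀) (boundaryMapSum U A Γ₁) := by
  have hdense := fun n => (hT n).dense_domain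
  have hadj := hA.adjoint hdense
  have hG := fun n => (hT n).greenIdentity
  have : ∀ n, CompleteSpace (K n) := fun n => (hT n).complete
  refine (GreenIdentity.directSum hadj hG).isBoundaryTriplet (.directSum hadj hR) hC
    (hA.dense_domain hdense) (hA.isClosed fun n => (hT n).isClosed)
    (hA.le_adjoint hdense fun n => (hT n).symmetric)
    (boundaryMapSum_domain hadj (C := C) (fun n => (hT n).dom₀) fun n f f' h₀ hf hf₀ => ?_)
    (boundaryMapSum_domain hadj (C := C) (fun n => (hT n).dom₁) fun n f f' h₁ hf hf₁ => ?_)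
  · obtain ⟨h₁, hf₁⟩ := LinearPMap.mem_domain_iff.1
      ((hT n).dom₁.ge (LinearPMap.mem_domain_of_mem_graph hf))
    exact (le_add_of_nonneg_right (sq_nonneg _)).trans
      ((hG n).norm_sq_add_norm_sq_le (hR n) hC hf hf₀ hf₁)
  · obtain ⟨h₀, hf₀⟩ := LinearPMap.mem_domain_iff.1
      ((hT n).dom₀.ge (LinearPMap.mem_domain_of_mem_graph hf))
    exact (le_add_of_nonneg_left (sq_nonneg _)).trans
      ((hG n).norm_sq_add_norm_sq_le (hR n) hC hf hf₀ hf₁)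

end DirectSumTriplet

section AbsolutelyContinuous

variable {E : Type*} [NormedAddCommGroup E] [NormedSpace ℝ E]

theorem absolutelyContinuousOnInterval_of_dist_le {X Y : Type*} [PseudoMetricSpace X]
    [PseudoMetricSpace Y] {f : ℝ → X} {g : ℝ → Y} {a b : ℝ}
    (hf : AbsolutelyContinuousOnInterval f a b)
    (h : ∀ s ∈ uIcc a b, ∀ t ∈ uIcc a b, dist (g s) (g t) ≤ dist (f s) (f t)) :
    AbsolutelyContinuousOnInterval g a b := by
  rw [absolutelyContinuousOnInterval_iff] at hf ⊢
  intro ε hε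
  obtain ⟨δ, hδ, hfδ⟩ := hf ε hε
  refine ⟨δ, hδ, fun P hP hPδ => (Finset.sum_le_sum fun i hi => ?_).trans_lt (hfδ P hP hPδ)⟩
  exact h _ (hP.1 i hi).1 _ (hP.1 i hi).2

theorem absolutelyContinuousOnInterval_of_sub_eq_integral {f g : ℝ → E} {a b : ℝ}
    (hg : IntervalIntegrable g volume a b)
    (hf : ∀ s ∈ uIcc a b, ∀ t ∈ uIcc a b, f t - f s = ∫ x in s..t, g x) :
    AbsolutelyContinuousOnInterval f a b := by
  refine absolutelyContinuousOnInterval_of_dist_le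
    (hg.norm.absolutelyContinuousOnInterval_intervalIntegral left_mem_uIcc) fun s hs t ht => ?_
  have hnorm : ∀ r ∈ uIcc a b, IntervalIntegrable (fun x => ‖g x‖) volume a r := fun r hr =>
    hg.norm.mono_set (uIcc_subset_uIcc left_mem_uIcc hr)
  rw [dist_comm, dist_eq_norm, hf s hs t ht, dist_comm, Real.dist_eq,
    intervalIntegral.integral_interval_sub_left (hnorm t ht) (hnorm s hs)]
  exact intervalIntegral.norm_integral_le_abs_integral_norm

theorem absolutelyContinuousOnInterval_primitive {g : ℝ → E} {a b c : ℝ}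
    (hg : IntervalIntegrable g volume a b) (hc : c ∈ uIcc a b) :
    AbsolutelyContinuousOnInterval (fun t => ∫ x in c..t, g x) a b :=
  absolutelyContinuousOnInterval_of_sub_eq_integral hg fun _ hs _ ht =>
    intervalIntegral.integral_interval_sub_left (hg.mono_set (uIcc_subset_uIcc hc ht))
      (hg.mono_set (uIcc_subset_uIcc hc hs))

theorem integral_eq_sub_of_absolutelyContinuousOnInterval [CompleteSpace E] {f f' : ℝ → E}
    {a b : ℝ} (hf : AbsolutelyContinuousOnInterval f a b) (hf' : IntervalIntegrable f' volume a b)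
    (hderiv : ∀ᵐ x, x ∈ uIcc a b → HasDerivAt f (f' x) x) :
    ∫ x in a..b, f' x = f b - f a := by
  have hprim := absolutelyContinuousOnInterval_primitive hf' left_mem_uIcc
  obtain ⟨c, hc⟩ := (hf.sub hprim).const_of_ae_hasDerivAt_zero (by
    filter_upwards [hderiv, hf'.ae_hasDerivAt_integral] with x hx hx' hxm
    simpa using (hx hxm).sub (hx' hxm a left_mem_uIcc))
  have hca := hc a left_mem_uIcc
  have hcb := hc b right_mem_uIcc
  simp only [Pi.sub_apply, intervalIntegral.integral_same, sub_zero] at hca hcb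
  rw [hca, ← hcb, sub_sub_cancel]

end AbsolutelyContinuous

section OrdConnected

variable {E : Type*} [NormedAddCommGroup E] {J : Set ℝ} {a s t : ℝ}

theorem locallyIntegrable_indicator_of_memLp (hJ : J.OrdConnected) {p : ENNReal} (hp : 1 ≤ p)
    {g : ℝ → E} (hg : MemLp g p (volume.restrict J)) :
    LocallyIntegrable (J.indicator g) volume :=
  ((memLp_indicator_iff_restrict hJ.measurableSet).2 hg).locallyIntegrable hp

theorem intervalIntegrable_of_memLp (hJ : J.OrdConnected) {p : ENNReal} (hp : 1 ≤ p) {g : ℝ → E}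
    (hg : MemLp g p (volume.restrict J)) (hs : s ∈ J) (ht : t ∈ J) :
    IntervalIntegrable g volume s t := by
  have hsub : uIoc s t ⊆ J := uIoc_subset_uIcc.trans (hJ.uIcc_subset hs ht)
  have hloc := (hg.locallyIntegrable hp).integrableOn_isCompact (isCompact_uIcc (a := s) (b := t))
  rw [intervalIntegrable_iff]
  have h := hloc.mono_set (uIoc_subset_uIcc (a := s) (b := t))
  rwa [IntegrableOn, Measure.restrict_restrict_of_subset hsub] at h

variable [NormedSpace ℝ E]

theorem ae_hasDerivAt_of_ae_hasDerivWithinAt (hJ : J.OrdConnected) {f f' : ℝ → E}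
    (h : ∀ᵐ x ∂volume.restrict J, HasDerivWithinAt f (f' x) J x) (hs : s ∈ J) (ht : t ∈ J) :
    ∀ᵐ x, x ∈ uIcc s t → HasDerivAt f (f' x) x := by
  have hendpoints : ∀ᵐ x, x ∉ ({min s t, max s t} : Set ℝ) :=
    measure_eq_zero_iff_ae_notMem.1 ((Set.toFinite _).measure_zero _)
  filter_upwards [(ae_restrict_iff' hJ.measurableSet).1 h, hendpoints] with x hx hne hxm
  rw [mem_insert_iff, mem_singleton_iff, not_or] at hne
  have hnhds : uIcc s t ∈ 𝓝 x :=
    Icc_mem_nhds (hxm.1.lt_of_ne (Ne.symm hne.1)) (hxm.2.lt_of_ne hne.2)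
  have hsub := hJ.uIcc_subset hs ht
  exact (hx (hsub hxm)).hasDerivAt (mem_of_superset hnhds hsub)

theorem hasDerivWithinAt_of_eq_add_integral [CompleteSpace E] (hJ : J.OrdConnected) (ha : a ∈ J)
    {f g : ℝ → E} (hg : ContinuousOn g J) (hf : ∀ r ∈ J, f r = f a + ∫ x in a..r, g x)
    (ht : t ∈ J) : HasDerivWithinAt f (g t) J t := by
  have hint : ∀ r ∈ J, ∀ s ∈ J, IntervalIntegrable g volume r s := fun r hr s hs =>
    (hg.mono (hJ.uIcc_subset hr hs)).intervalIntegrable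
  rw [hasDerivWithinAt_iff_isLittleO, Asymptotics.isLittleO_iff]
  intro ε hε
  obtain ⟨δ, hδ, hclose⟩ := Metric.continuousWithinAt_iff.1 (hg t ht) ε hε
  filter_upwards [self_mem_nhdsWithin, mem_nhdsWithin_of_mem_nhds (Metric.ball_mem_nhds t hδ)]
    with s hs hst
  have hincr : f s - f t - (s - t) • g t = ∫ x in t..s, (g x - g t) := by
    rw [intervalIntegral.integral_sub (hint t ht s hs) intervalIntegrable_const,
      intervalIntegral.integral_const, hf s hs, hf t ht, add_sub_add_left_eq_sub,
      intervalIntegral.integral_interval_sub_left (hint a ha s hs) (hint a ha t ht)]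
  rw [hincr]
  refine intervalIntegral.norm_integral_le_of_norm_le_const fun x hx => ?_
  have hx' := uIoc_subset_uIcc hx
  rw [← dist_eq_norm]
  refine (hclose (hJ.uIcc_subset ht hs hx') ?_).le
  rw [Real.dist_eq]
  exact (abs_sub_left_of_mem_uIcc hx').trans_lt hst

theorem eqOn_add_integral_indicator (hJ : J.OrdConnected) (ha : a ∈ J) {f g : ℝ → E}
    (hf : ∀ r ∈ J, f r = f a + ∫ x in a..r, g x) :
    EqOn f (fun r => f a + ∫ x in a..r, J.indicator g x) J := fun r hr => by
  refine (hf r hr).trans (congrArg (f a + ·) (intervalIntegral.integral_congr fun x hx => ?_))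
  exact (indicator_of_mem (hJ.uIcc_subset ha hr hx) g).symm

theorem continuousOn_of_eq_add_integral (hJ : J.OrdConnected) (ha : a ∈ J) {p : ENNReal}
    (hp : 1 ≤ p) {f g : ℝ → E} (hg : MemLp g p (volume.restrict J))
    (hf : ∀ r ∈ J, f r = f a + ∫ x in a..r, g x) : ContinuousOn f J := by
  have hloc := locallyIntegrable_indicator_of_memLp hJ hp hg
  have hcont := intervalIntegral.continuous_primitive (fun _ _ => intervalIntegrable_iff.2
    ((hloc.integrableOn_isCompact isCompact_uIcc).mono_set uIoc_subset_uIcc)) a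
  exact (continuous_const.add hcont).continuousOn.congr (eqOn_add_integral_indicator hJ ha hf)

theorem ae_hasDerivWithinAt_of_eq_add_integral [CompleteSpace E] (hJ : J.OrdConnected)
    (ha : a ∈ J) {p : ENNReal} (hp : 1 ≤ p) {f g : ℝ → E} (hg : MemLp g p (volume.restrict J))
    (hf : ∀ r ∈ J, f r = f a + ∫ x in a..r, g x) :
    ∀ᵐ t ∂volume.restrict J, HasDerivWithinAt f (g t) J t := by
  have hf' := eqOn_add_integral_indicator hJ ha hf
  have hloc := locallyIntegrable_indicator_of_memLp hJ hp hg
  filter_upwards [ae_restrict_of_ae (LocallyIntegrable.ae_hasDerivAt_integral hloc),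
    ae_restrict_mem hJ.measurableSet] with t hderiv ht
  have h := (hderiv a).const_add (f a)
  rw [indicator_of_mem ht] at h
  exact h.hasDerivWithinAt.congr hf' (hf' ht)

end OrdConnected

theorem isACLoc_of_eq_add_integral {J : Set ℝ} (hJ : J.OrdConnected) {a : ℝ} (ha : a ∈ J)
    {f g : ℝ → ℂ} (hg : ∀ s ∈ J, ∀ t ∈ J, IntervalIntegrable g volume s t)
    (hf : ∀ t ∈ J, f t = f a + ∫ x in a..t, g x) : IsACLoc J f := by
  refine fun s hs t ht => absolutelyContinuousOnInterval_of_sub_eq_integral (hg s hs t ht)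
    fun p hp q hq => ?_
  have hpJ := hJ.uIcc_subset hs ht hp
  have hqJ := hJ.uIcc_subset hs ht hq
  rw [hf p hpJ, hf q hqJ, add_sub_add_left_eq_sub,
    intervalIntegral.integral_interval_sub_left (hg a ha q hqJ) (hg a ha p hpJ)]

theorem IsInterval.ordConnected {J : Set ℝ} (hJ : IsInterval J) : J.OrdConnected :=
  hJ.convex.ordConnected

theorem L2.intervalIntegrable {J : Set ℝ} (hJ : IsInterval J) (w : L2 J) {s t : ℝ} (hs : s ∈ J)
    (ht : t ∈ J) : IntervalIntegrable w volume s t :=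
  intervalIntegrable_of_memLp hJ.ordConnected one_le_two (Lp.memLp w) hs ht

namespace IsRep

variable {J : Set ℝ} {f : L2 J} {u v : ℝ → ℂ} {w : L2 J}

theorem ae_hasDerivAt (h : IsRep J f u v w) (hJ : IsInterval J) {s t : ℝ} (hs : s ∈ J)
    (ht : t ∈ J) : ∀ᵐ x, x ∈ uIcc s t → HasDerivAt u (v x) x :=
  ae_hasDerivAt_of_ae_hasDerivWithinAt hJ.ordConnected
    (ae_restrict_of_forall_mem hJ.ordConnected.measurableSet h.hasDeriv) hs ht

theorem ae_hasDerivAt_deriv (h : IsRep J f u v w) (hJ : IsInterval J) {s t : ℝ} (hs : s ∈ J)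
    (ht : t ∈ J) : ∀ᵐ x, x ∈ uIcc s t → HasDerivAt v (w x) x :=
  ae_hasDerivAt_of_ae_hasDerivWithinAt hJ.ordConnected h.hasDeriv_deriv hs ht

theorem integral_deriv (h : IsRep J f u v w) (hJ : IsInterval J) {s t : ℝ} (hs : s ∈ J)
    (ht : t ∈ J) : ∫ x in s..t, v x = u t - u s :=
  integral_eq_sub_of_absolutelyContinuousOnInterval (h.ac s hs t ht)
    (h.ac_deriv s hs t ht).continuousOn.intervalIntegrable (h.ae_hasDerivAt hJ hs ht)

theorem integral_deriv_deriv (h : IsRep J f u v w) (hJ : IsInterval J) {s t : ℝ} (hs : s ∈ J)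
    (ht : t ∈ J) : ∫ x in s..t, w x = v t - v s :=
  integral_eq_sub_of_absolutelyContinuousOnInterval (h.ac_deriv s hs t ht)
    (L2.intervalIntegrable hJ w hs ht) (h.ae_hasDerivAt_deriv hJ hs ht)

theorem of_eq_add_integral (hJ : IsInterval J) {a : ℝ} (ha : a ∈ J)
    (hf : f =ᵐ[volume.restrict J] u) (hu : ∀ t ∈ J, u t = u a + ∫ x in a..t, v x)
    (hv : ∀ t ∈ J, v t = v a + ∫ x in a..t, w x) : IsRep J f u v w := by
  have hord := hJ.ordConnected
  have hv_cont := continuousOn_of_eq_add_integral hord ha one_le_two (Lp.memLp w) hv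
  exact
    { ae_eq := hf
      ac := isACLoc_of_eq_add_integral hord ha
        (fun s hs t ht => (hv_cont.mono (hord.uIcc_subset hs ht)).intervalIntegrable) hu
      hasDeriv := fun t ht => hasDerivWithinAt_of_eq_add_integral hord ha hv_cont hu ht
      ac_deriv := isACLoc_of_eq_add_integral hord ha
        (fun s hs t ht => L2.intervalIntegrable hJ w hs ht) hv
      hasDeriv_deriv :=
        ae_hasDerivWithinAt_of_eq_add_integral hord ha one_le_two (Lp.memLp w) hv }

end IsRep

theorem memLp_of_continuousOn_Icc {E : Type*} [NormedAddCommGroup E] {a b : ℝ} {p : ENNReal}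
    {f : ℝ → E} (hf : ContinuousOn f (Icc a b)) : MemLp f p (volume.restrict (Icc a b)) := by
  obtain ⟨C, hC⟩ := isCompact_Icc.exists_bound_of_continuousOn hf
  exact MemLp.of_bound (hf.aestronglyMeasurable_of_isCompact isCompact_Icc measurableSet_Icc) C
    (ae_restrict_of_forall_mem measurableSet_Icc hC)

section Interval

variable {a b : ℝ}

theorem exists_isRep_Icc (hab : a < b) (w : L2 (Icc a b)) (α β : ℂ) :
    ∃ f u v, IsRep (Icc a b) f u v w ∧ u a = α ∧ v a = β := by
  have hJ := isInterval_Icc hab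
  have ha := left_mem_Icc.2 hab.le
  let v : ℝ → ℂ := fun t => β + ∫ x in a..t, w x
  let u : ℝ → ℂ := fun t => α + ∫ x in a..t, v x
  have hva : v a = β := by simp [v]
  have hua : u a = α := by simp [u]
  have hv : ContinuousOn v (Icc a b) := continuousOn_of_eq_add_integral hJ.ordConnected ha
    one_le_two (Lp.memLp w) fun t _ => by rw [hva]
  have hu : ContinuousOn u (Icc a b) := continuousOn_of_eq_add_integral hJ.ordConnected ha
    one_le_two (memLp_of_continuousOn_Icc hv) fun t _ => by rw [hua]
  exact ⟨(memLp_of_continuousOn_Icc hu).toLp u, u, v,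
    IsRep.of_eq_add_integral hJ ha (MemLp.coeFn_toLp _) (fun t _ => by rw [hua])
      (fun t _ => by rw [hva]), hua, hva⟩

theorem exists_isRep_of_hasDerivAt (hab : a < b) {u v w : ℝ → ℂ}
    (hu : ∀ t, HasDerivAt u (v t) t) (hv : ∀ t, HasDerivAt v (w t) t) (hw : Continuous w) :
    ∃ f z, IsRep (Icc a b) f u v z ∧ z =ᵐ[volume.restrict (Icc a b)] w := by
  have hJ := isInterval_Icc hab
  have ha := left_mem_Icc.2 hab.le
  have huc : Continuous u := continuous_iff_continuousAt.2 fun t => (hu t).continuousAt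
  have hvc : Continuous v := continuous_iff_continuousAt.2 fun t => (hv t).continuousAt
  have hw_mem : MemLp w 2 (volume.restrict (Icc a b)) := memLp_of_continuousOn_Icc hw.continuousOn
  have hw_ae := (ae_restrict_iff' measurableSet_Icc).1 hw_mem.coeFn_toLp
  refine ⟨(memLp_of_continuousOn_Icc huc.continuousOn).toLp u, hw_mem.toLp w,
    IsRep.of_eq_add_integral hJ ha (MemLp.coeFn_toLp _) (fun t _ => ?_) (fun t ht => ?_),
    hw_mem.coeFn_toLp⟩
  · rw [intervalIntegral.integral_eq_sub_of_hasDerivAt (fun x _ => hu x)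
      (hvc.intervalIntegrable _ _), add_sub_cancel]
  · have hcongr : ∫ x in a..t, (hw_mem.toLp w) x = ∫ x in a..t, w x := by
      refine intervalIntegral.integral_congr_ae ?_
      filter_upwards [hw_ae] with x hx hxm
      exact hx (hJ.ordConnected.uIcc_subset ha ht (uIoc_subset_uIcc hxm))
    rw [hcongr, intervalIntegral.integral_eq_sub_of_hasDerivAt (fun x _ => hv x)
      (hw.intervalIntegrable _ _), add_sub_cancel]

theorem L2.inner_sub_inner_eq_intervalIntegral (hab : a ≤ b) (f g w z : L2 (Icc a b)) :
    inner ℂ g w - inner ℂ z f = ∫ t in a..b, (inner ℂ (g t) (w t) - inner ℂ (z t) (f t)) := by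
  rw [MeasureTheory.L2.inner_def, MeasureTheory.L2.inner_def,
    ← integral_sub (MeasureTheory.L2.integrable_inner g w) (MeasureTheory.L2.integrable_inner z f),
    integral_Icc_eq_integral_Ioc, ← intervalIntegral.integral_of_le hab]

theorem IsRep.green (hab : a < b) {f g w z : L2 (Icc a b)} {u v p q : ℝ → ℂ}
    (hf : IsRep (Icc a b) f u v w) (hg : IsRep (Icc a b) g p q z) :
    inner ℂ g w - inner ℂ z f =
      (star (p b) * v b - star (q b) * u b) - (star (p a) * v a - star (q a) * u a) := by
  have hJ := isInterval_Icc hab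
  have ha := left_mem_Icc.2 hab.le
  have hb := right_mem_Icc.2 hab.le
  have hstar : ∀ {h : ℝ → ℂ}, AbsolutelyContinuousOnInterval h a b →
      AbsolutelyContinuousOnInterval (fun t => star (h t)) a b := fun hh =>
    absolutelyContinuousOnInterval_of_dist_le hh fun s _ t _ => (dist_star_star _ _).le
  have hwronskian : AbsolutelyContinuousOnInterval
      (fun t => star (p t) * v t - star (q t) * u t) a b :=
    ((hstar (hg.ac a ha b hb)).smul (hf.ac_deriv a ha b hb)).sub
      ((hstar (hg.ac_deriv a ha b hb)).smul (hf.ac a ha b hb))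
  have hint : IntervalIntegrable (fun t => inner ℂ (g t) (w t) - inner ℂ (z t) (f t))
      volume a b := by
    rw [intervalIntegrable_iff_integrableOn_Icc_of_le hab.le]
    exact (MeasureTheory.L2.integrable_inner g w).sub (MeasureTheory.L2.integrable_inner z f)
  rw [L2.inner_sub_inner_eq_intervalIntegral hab.le,
    integral_eq_sub_of_absolutelyContinuousOnInterval hwronskian hint]
  filter_upwards [hf.ae_hasDerivAt hJ ha hb, hf.ae_hasDerivAt_deriv hJ ha hb,
    hg.ae_hasDerivAt hJ ha hb, hg.ae_hasDerivAt_deriv hJ ha hb,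
    (ae_restrict_iff' measurableSet_Icc).1 hf.ae_eq,
    (ae_restrict_iff' measurableSet_Icc).1 hg.ae_eq] with t hu hv hp hq hfu hgp ht
  have ht' : t ∈ Icc a b := by rwa [uIcc_of_le hab.le] at ht
  refine (((hp ht).star.mul (hv ht)).sub ((hq ht).star.mul (hu ht))).congr_deriv ?_
  rw [hfu ht', hgp ht', RCLike.inner_apply', RCLike.inner_apply']
  simp only [starRingEnd_apply]
  ring

end Interval

theorem mem_graph_negSecondDeriv {J : Set ℝ} (hJ : IsInterval J) {f g : L2 J} :
    (f, g) ∈ (negSecondDeriv hJ).graph ↔ ∃ u v, IsRep J f u v (-g) := by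
  rw [LinearPMap.mem_graph_iff]
  constructor
  · rintro ⟨y, rfl, hg⟩
    have hg' : -secondDeriv y = g := hg
    refine ⟨rep y, repDeriv y, ?_⟩
    rw [← hg', neg_neg]
    exact isRep y
  · rintro ⟨u, v, h⟩
    refine ⟨⟨f, ⟨u, v, _, h⟩⟩, rfl, ?_⟩
    have hsecond : secondDeriv (⟨f, ⟨u, v, _, h⟩⟩ : W22 J) = -g :=
      ((isRep (⟨f, ⟨u, v, _, h⟩⟩ : W22 J)).unique hJ h).2.2
    change -secondDeriv (⟨f, ⟨u, v, _, h⟩⟩ : W22 J) = g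
    rw [hsecond, neg_neg]

theorem mem_graph_minimalOperator {J : Set ℝ} (hJ : IsInterval J) {X : Set ℝ} {f g : L2 J} :
    (f, g) ∈ (minimalOperator hJ X).graph ↔
      ∃ u v, IsRep J f u v (-g) ∧ ∀ t ∈ X, u t = 0 ∧ v t = 0 := by
  rw [minimalOperator, mem_graph_domRestrict, mem_graph_negSecondDeriv]
  constructor
  · rintro ⟨⟨u, v, w, h, h0⟩, u', v', h'⟩
    rw [← (h.unique hJ h').2.2]
    exact ⟨u, v, h, h0⟩
  · rintro ⟨u, v, h, h0⟩
    exact ⟨⟨u, v, _, h, h0⟩, u, v, h⟩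

section Interval

variable {a b : ℝ}

theorem exists_isRep_affine (hab : a < b) (α β : ℂ) :
    ∃ e, IsRep (Icc a b) e (fun t => α + β * ((t - b : ℝ) : ℂ)) (fun _ => β) 0 := by
  obtain ⟨e, z, he, hz⟩ := exists_isRep_of_hasDerivAt hab
    (u := fun t => α + β * ((t - b : ℝ) : ℂ)) (v := fun _ => β) (w := fun _ => 0)
    (fun t => by
      simpa using (((hasDerivAt_id t).sub_const b).ofReal_comp.const_mul β).const_add α)
    (fun t => hasDerivAt_const _ _) continuous_const
  rw [Lp.ext (hz.trans (Lp.coeFn_zero _ _ _).symm)] at he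
  exact ⟨e, he⟩

theorem exists_mem_graph_intervalOperator_of_orthogonal (hab : a < b) {e₀ e₁ w : L2 (Icc a b)}
    (h₀ : IsRep (Icc a b) e₀ (fun t => 1 + 0 * ((t - b : ℝ) : ℂ)) (fun _ => 0) 0)
    (h₁ : IsRep (Icc a b) e₁ (fun t => 0 + 1 * ((t - b : ℝ) : ℂ)) (fun _ => 1) 0)
    (hw₀ : inner ℂ e₀ w = 0) (hw₁ : inner ℂ e₁ w = 0) :
    ∃ φ, (φ, -w) ∈ (intervalOperator hab).graph := by
  obtain ⟨φ, u, v, h, hua, hva⟩ := exists_isRep_Icc hab w 0 0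
  have hvb : v b = 0 := by simpa [hw₀, hua, hva] using (h.green hab h₀).symm
  have hub : u b = 0 := by simpa [hw₁, hua, hva] using h.green hab h₁
  refine ⟨φ, (mem_graph_minimalOperator _).2 ⟨u, v, by rwa [neg_neg], ?_⟩⟩
  rintro t (rfl | rfl)
  exacts [⟨hua, hva⟩, ⟨hub, hvb⟩]

/-- By the Green identity, `w` is in the range of the minimal operator as soon as it is orthogonal
to the affine functions. These form a finite-dimensional, hence closed, subspace, which is
therefore its own double orthogonal complement. -/
theorem exists_isRep_zero_of_orthogonal (hab : a < b) {f : L2 (Icc a b)}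
    (hf : ∀ p q, (p, q) ∈ (intervalOperator hab).graph → inner ℂ q f = 0) :
    ∃ u v, IsRep (Icc a b) f u v 0 := by
  obtain ⟨e₀, h₀⟩ := exists_isRep_affine hab 1 0
  obtain ⟨e₁, h₁⟩ := exists_isRep_affine hab 0 1
  let K : Submodule ℂ (L2 (Icc a b)) := Submodule.span ℂ {e₀, e₁}
  have hK : f ∈ Kᗮᗮ := by
    intro w hw
    obtain ⟨φ, hφ⟩ := exists_mem_graph_intervalOperator_of_orthogonal hab h₀ h₁
      (hw _ (Submodule.subset_span (by simp))) (hw _ (Submodule.subset_span (by simp)))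
    have hneg := hf _ _ hφ
    rwa [inner_neg_left, neg_eq_zero] at hneg
  have : FiniteDimensional ℂ K := FiniteDimensional.span_of_finite ℂ (by simp)
  rw [Submodule.orthogonal_orthogonal] at hK
  obtain ⟨α, β, rfl⟩ := Submodule.mem_span_pair.1 hK
  have h := (h₀.smul α).add (h₁.smul β)
  simp only [smul_zero, add_zero] at h
  exact ⟨_, _, h⟩

theorem inner_graph_intervalOperator (hab : a < b) {f g φ ψ : L2 (Icc a b)}
    (hf : (f, g) ∈ (negSecondDeriv (isInterval_Icc hab)).graph)
    (hφ : (φ, ψ) ∈ (intervalOperator hab).graph) : inner ℂ ψ f = inner ℂ φ g := by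
  obtain ⟨u, v, h⟩ := (mem_graph_negSecondDeriv _).1 hf
  obtain ⟨p, q, h', h0⟩ := (mem_graph_minimalOperator _).1 hφ
  have hgreen := h.green hab h'
  obtain ⟨hpa, hqa⟩ := h0 a (by simp)
  obtain ⟨hpb, hqb⟩ := h0 b (by simp)
  rw [hpa, hqa, hpb, hqb, inner_neg_right, inner_neg_left] at hgreen
  simp only [star_zero, zero_mul, sub_self] at hgreen
  linear_combination hgreen

theorem dense_domain_intervalOperator (hab : a < b) :
    Dense ((intervalOperator hab).domain : Set (L2 (Icc a b))) := by
  rw [Submodule.dense_iff_topologicalClosure_eq_top, Submodule.topologicalClosure_eq_top_iff,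
    Submodule.eq_bot_iff]
  intro f hf
  obtain ⟨h, u, v, hr, -, -⟩ := exists_isRep_Icc hab (-f) 0 0
  obtain ⟨u', v', hr'⟩ := exists_isRep_zero_of_orthogonal hab (f := h) fun p q hpq => by
    rw [inner_graph_intervalOperator hab ((mem_graph_negSecondDeriv _).2 ⟨u, v, hr⟩) hpq]
    exact hf _ (LinearPMap.mem_domain_of_mem_graph hpq)
  exact neg_eq_zero.1 (hr.unique (isInterval_Icc hab) hr').2.2

theorem adjoint_intervalOperator (hab : a < b) :
    (intervalOperator hab).adjoint = negSecondDeriv (isInterval_Icc hab) := by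
  refine LinearPMap.eq_of_eq_graph (le_antisymm ?_ ?_)
  · rintro ⟨f, g⟩ hfg
    rw [mem_graph_adjoint (dense_domain_intervalOperator hab)] at hfg
    obtain ⟨h, u, v, hr, -, -⟩ := exists_isRep_Icc hab (-g) 0 0
    obtain ⟨u', v', hr'⟩ := exists_isRep_zero_of_orthogonal hab (f := f - h) fun p q hpq => by
      rw [inner_sub_right, hfg p q hpq,
        inner_graph_intervalOperator hab ((mem_graph_negSecondDeriv _).2 ⟨u, v, hr⟩) hpq, sub_self]
    have hf := hr'.add hr
    rw [sub_add_cancel, zero_add] at hf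
    exact (mem_graph_negSecondDeriv _).2 ⟨_, _, hf⟩
  · rintro ⟨f, g⟩ hfg
    rw [mem_graph_adjoint (dense_domain_intervalOperator hab)]
    exact fun p q hpq => inner_graph_intervalOperator hab hfg hpq

theorem mem_graph_adjoint_intervalOperator (hab : a < b) {f g : L2 (Icc a b)} :
    (f, g) ∈ (intervalOperator hab).adjoint.graph ↔ ∃ u v, IsRep (Icc a b) f u v (-g) := by
  rw [adjoint_intervalOperator, mem_graph_negSecondDeriv]

theorem intervalOperator_le_adjoint (hab : a < b) :
    intervalOperator hab ≤ (intervalOperator hab).adjoint := by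
  rw [adjoint_intervalOperator]
  exact LinearPMap.domRestrict_le

theorem norm_le_of_ae_bound_Icc (hab : a < b) {f : L2 (Icc a b)} {u : ℝ → ℂ}
    (hf : f =ᵐ[volume.restrict (Icc a b)] u) {M : ℝ} (hM : 0 ≤ M)
    (hu : ∀ t ∈ Icc a b, ‖u t‖ ≤ M) : ‖f‖ ≤ (b - a) ^ (1 / 2 : ℝ) * M := by
  have hbound := Lp.norm_le_of_ae_bound (f := f) hM (by
    filter_upwards [hf, ae_restrict_mem measurableSet_Icc] with t hft ht
    rw [hft]
    exact hu t ht)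
  have hlength : (measureUnivNNReal (volume.restrict (Icc a b)) : ℝ) = b - a := by
    simp only [measureUnivNNReal, Measure.restrict_apply_univ, Real.volume_Icc]
    exact ENNReal.toReal_ofReal (sub_pos.2 hab).le
  rw [hlength] at hbound
  exact hbound.trans_eq (by norm_num)

/-- The affine parametrization of `[a, b]` by `[0, 1]`, in which the Hermite interpolation
polynomials on `[a, b]` have coefficients independent of the length `b - a`. -/
noncomputable def unitParam (a b t : ℝ) : ℂ := ((t - a : ℝ) : ℂ) / ((b - a : ℝ) : ℂ)

theorem unitParam_left : unitParam a b a = 0 := by simp [unitParam]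

theorem unitParam_right (hab : a < b) : unitParam a b b = 1 :=
  div_self (Complex.ofReal_ne_zero.2 (sub_pos.2 hab).ne')

theorem hasDerivAt_unitParam (t : ℝ) :
    HasDerivAt (unitParam a b) (1 / ((b - a : ℝ) : ℂ)) t := by
  have h := (((hasDerivAt_id t).sub_const a).ofReal_comp).div_const ((b - a : ℝ) : ℂ)
  rwa [Complex.ofReal_one] at h

theorem norm_unitParam_le_one (hab : a < b) {t : ℝ} (ht : t ∈ Icc a b) :
    ‖unitParam a b t‖ ≤ 1 := by
  rw [unitParam, norm_div, Complex.norm_real, Complex.norm_real,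
    Real.norm_of_nonneg (sub_nonneg.2 ht.1), Real.norm_of_nonneg (sub_pos.2 hab).le]
  exact div_le_one_of_le₀ (sub_le_sub_right ht.2 a) (sub_pos.2 hab).le

theorem norm_const_mul_unitParam_pow_le (hab : a < b) {t : ℝ} (ht : t ∈ Icc a b) (c : ℂ) (k : ℕ) :
    ‖c * unitParam a b t ^ k‖ ≤ ‖c‖ := by
  rw [norm_mul, norm_pow]
  exact mul_le_of_le_one_right (norm_nonneg _)
    (pow_le_one₀ (norm_nonneg _) (norm_unitParam_le_one hab ht))

theorem exists_isRep_cubic (hab : a < b) (c₀ c₁ c₂ c₃ : ℂ) :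
    ∃ f u v z, IsRep (Icc a b) f u v z ∧ u a = c₀ ∧ u b = c₀ + c₁ + c₂ + c₃ ∧
      v a = c₁ / (b - a : ℝ) ∧ v b = (c₁ + 2 * c₂ + 3 * c₃) / (b - a : ℝ) ∧
      ‖f‖ ≤ (b - a) ^ (1 / 2 : ℝ) * (‖c₀‖ + ‖c₁‖ + ‖c₂‖ + ‖c₃‖) ∧
      ‖z‖ ≤ (b - a) ^ (1 / 2 : ℝ) * ((2 * ‖c₂‖ + 6 * ‖c₃‖) / (b - a) ^ 2) := by
  set s := unitParam a b with hs_def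
  have hs := hasDerivAt_unitParam (a := a) (b := b)
  have hs_cont : Continuous s := continuous_iff_continuousAt.2 fun t => (hs t).continuousAt
  have hle := @norm_const_mul_unitParam_pow_le a b hab
  obtain ⟨f, z, hf, hz⟩ := exists_isRep_of_hasDerivAt hab
    (u := fun t => c₀ + c₁ * s t ^ 1 + c₂ * s t ^ 2 + c₃ * s t ^ 3)
    (v := fun t => (c₁ + 2 * c₂ * s t + 3 * c₃ * s t ^ 2) / (b - a : ℝ))
    (w := fun t => (2 * c₂ + 6 * c₃ * s t ^ 1) / (b - a : ℝ) ^ 2)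
    (fun t => ((((((hs t).pow 1).const_mul c₁).const_add c₀).add (((hs t).pow 2).const_mul c₂)).add
      (((hs t).pow 3).const_mul c₃)).congr_deriv (by push_cast; ring))
    (fun t => (((((hs t).const_mul (2 * c₂)).const_add c₁).add
      (((hs t).pow 2).const_mul (3 * c₃))).div_const _).congr_deriv
        (by field_simp; push_cast; ring))
    (by fun_prop)
  refine ⟨f, _, _, z, hf, ?_, ?_, ?_, ?_,
    norm_le_of_ae_bound_Icc hab hf.ae_eq (by positivity) fun t ht => ?_,
    norm_le_of_ae_bound_Icc hab hz (by positivity) fun t ht => ?_⟩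
  · simp [hs_def, unitParam_left]
  · simp [hs_def, unitParam_right hab]
  · simp [hs_def, unitParam_left]
  · simp [hs_def, unitParam_right hab]
  · exact (norm_add₄_le).trans (by gcongr <;> exact hle ht _ _)
  · rw [norm_div, norm_pow, Complex.norm_real, Real.norm_of_nonneg (sub_pos.2 hab).le]
    gcongr
    refine (norm_add_le _ _).trans (add_le_add (by simp) ((hle ht _ _).trans (by simp)))

theorem exists_isRep_hermite (hab : a < b) (α β δ ε : ℂ) :
    ∃ f u v z, IsRep (Icc a b) f u v z ∧ u a = α ∧ u b = β ∧
      (b - a : ℝ) * v a + (u a - u b) = δ ∧ (b - a : ℝ) * v b + (u a - u b) = ε ∧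
      ‖f‖ ≤ (b - a) ^ (1 / 2 : ℝ) * (2 * ‖α‖ + ‖β‖ + 4 * ‖δ‖ + 2 * ‖ε‖) ∧
      ‖z‖ ≤ (b - a) ^ (1 / 2 : ℝ) * ((10 * ‖δ‖ + 8 * ‖ε‖) / (b - a) ^ 2) := by
  have hd : ((b - a : ℝ) : ℂ) ≠ 0 := Complex.ofReal_ne_zero.2 (sub_pos.2 hab).ne'
  have hd₀ : (0 : ℝ) ≤ (b - a) ^ (1 / 2 : ℝ) := Real.rpow_nonneg (sub_pos.2 hab).le _
  obtain ⟨f, u, v, z, hf, hua, hub, hva, hvb, hf_le, hz_le⟩ :=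
    exists_isRep_cubic hab α (δ - α + β) (-(2 * δ + ε)) (δ + ε)
  have h₁ : ‖δ - α + β‖ ≤ ‖δ‖ + ‖α‖ + ‖β‖ := norm_add_le_of_le (norm_sub_le _ _) le_rfl
  have h₂ : ‖-(2 * δ + ε)‖ ≤ 2 * ‖δ‖ + ‖ε‖ := by
    rw [norm_neg]
    exact norm_add_le_of_le (by simp) le_rfl
  have h₃ := norm_add_le δ ε
  refine ⟨f, u, v, z, hf, hua, ?_, ?_, ?_, hf_le.trans ?_, hz_le.trans ?_⟩
  · rw [hub]
    ring
  · rw [hva, mul_div_cancel₀ _ hd, hua, hub]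
    ring
  · rw [hvb, mul_div_cancel₀ _ hd, hua, hub]
    ring
  · exact mul_le_mul_of_nonneg_left (by linarith) hd₀
  · exact mul_le_mul_of_nonneg_left
      (div_le_div_of_nonneg_right (by linarith) (sq_nonneg _)) hd₀

theorem exists_isRep_of_boundary_values (hab : a < b) (α β α' β' : ℂ) :
    ∃ f u v z, IsRep (Icc a b) f u v z ∧ u a = α ∧ u b = β ∧ v a = α' ∧ v b = β' := by
  have hd : ((b - a : ℝ) : ℂ) ≠ 0 := Complex.ofReal_ne_zero.2 (sub_pos.2 hab).ne'
  obtain ⟨f, u, v, z, hf, hua, hub, hva, hvb, -, -⟩ := exists_isRep_hermite hab α β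
    ((b - a : ℝ) * α' + (α - β)) ((b - a : ℝ) * β' + (α - β))
  rw [hua, hub, add_left_inj] at hva hvb
  exact ⟨f, u, v, z, hf, hua, hub, mul_left_cancel₀ hd hva, mul_left_cancel₀ hd hvb⟩

/-- An element of `dom A††` has a vanishing boundary form against every element of `dom A†`; the
boundary values of the latter are arbitrary, so they can be chosen to make that form the sum of
the squared absolute values of the boundary values of the former. -/
theorem isClosed_intervalOperator (hab : a < b) : (intervalOperator hab).IsClosed := by
  have hdense := dense_domain_intervalOperator hab
  have hsymm := intervalOperator_le_adjoint hab
  refine isClosed_of_adjoint_adjoint_le hdense hsymm (LinearPMap.le_of_le_graph ?_)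
  rintro ⟨f, g⟩ hfg
  rw [mem_graph_adjoint (hdense.mono hsymm.1)] at hfg
  have hf : (f, g) ∈ (intervalOperator hab).adjoint.graph :=
    (mem_graph_adjoint hdense).2 fun p q hpq => hfg p q (LinearPMap.le_graph_of_le hsymm hpq)
  obtain ⟨u, v, hr⟩ := (mem_graph_adjoint_intervalOperator hab).1 hf
  obtain ⟨k, p, q, z, hk, hpa, hpb, hqa, hqb⟩ :=
    exists_isRep_of_boundary_values hab (-v a) (v b) (u a) (-u b)
  have hzero := hfg k (-z)
    ((mem_graph_adjoint_intervalOperator hab).2 ⟨p, q, by rwa [neg_neg]⟩)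
  have hgreen := hr.green hab hk
  rw [hpa, hpb, hqa, hqb] at hgreen
  rw [inner_neg_left] at hzero
  rw [inner_neg_right, ← hzero] at hgreen
  have hnorm : ‖v b‖ ^ 2 + ‖u b‖ ^ 2 + ‖v a‖ ^ 2 + ‖u a‖ ^ 2 = 0 := by
    apply Complex.ofReal_injective
    push_cast
    simp only [← Complex.conj_mul', starRingEnd_apply]
    simp only [star_neg] at hgreen
    linear_combination -hgreen
  refine (mem_graph_minimalOperator _).2 ⟨u, v, hr, ?_⟩
  rintro t (rfl | rfl) <;> constructor <;> rw [← norm_eq_zero, ← sq_eq_zero_iff] <;> nlinarith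

end Interval

namespace IsPartition

variable {b : EReal} {x : ℕ → ℝ}

theorem mem_halfOpen (hx : IsPartition b x) (n : ℕ) : x n ∈ halfOpen b :=
  hx.cell_subset n (left_mem_Icc.2 (hx.step n).le)

theorem isRep_restrictCell (hx : IsPartition b x) {f w : L2 (halfOpen b)} {u v : ℝ → ℂ}
    (h : IsRep (halfOpen b) f u v w) (n : ℕ) :
    IsRep (cell x n) (hx.restrictCell n f) u v (hx.restrictCell n w) where
  ae_eq := (hx.restrictCell_ae n f).trans
    (ae_restrict_of_ae_restrict_of_subset (hx.cell_subset n) h.ae_eq)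
  ac s hs t ht := h.ac s (hx.cell_subset n hs) t (hx.cell_subset n ht)
  hasDeriv t ht := (h.hasDeriv t (hx.cell_subset n ht)).mono (hx.cell_subset n)
  ac_deriv s hs t ht := h.ac_deriv s (hx.cell_subset n hs) t (hx.cell_subset n ht)
  hasDeriv_deriv := by
    filter_upwards [hx.restrictCell_ae n w,
      ae_restrict_of_ae_restrict_of_subset (hx.cell_subset n) h.hasDeriv_deriv] with t hwt hvt
    rw [hwt]
    exact hvt.mono (hx.cell_subset n)

theorem ae_eq_of_cells (hx : IsPartition b x) {β : Type*} {F G : ℝ → β}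
    (h : ∀ n, F =ᵐ[volume.restrict (cell x n)] G) : F =ᵐ[volume.restrict (halfOpen b)] G := by
  rw [EventuallyEq, hx.restrict_eq_sum, Measure.ae_sum_iff]
  exact h

theorem integral_eq_of_cells (hx : IsPartition b x) {E : Type*} [NormedAddCommGroup E]
    [NormedSpace ℝ E] {g : ℝ → E} {G : ℕ → ℝ → E}
    (hg : ∀ s ∈ halfOpen b, ∀ t ∈ halfOpen b, IntervalIntegrable g volume s t)
    (hG : ∀ n, ∀ t ∈ cell x n, ∫ r in x n..t, g r = G n t) (h0 : ∀ n, G n (x (n + 1)) = 0)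
    (n : ℕ) {t : ℝ} (ht : t ∈ cell x n) : ∫ r in x 0..t, g r = G n t := by
  have hnode (n : ℕ) : ∫ r in x 0..x n, g r = 0 := by
    induction n with
    | zero => exact intervalIntegral.integral_same
    | succ n ih =>
      rw [← intervalIntegral.integral_add_adjacent_intervals
        (hg _ (hx.mem_halfOpen 0) _ (hx.mem_halfOpen n))
        (hg _ (hx.mem_halfOpen n) _ (hx.mem_halfOpen (n + 1))), ih,
        hG n _ (right_mem_Icc.2 (hx.step n).le), h0, add_zero]
  rw [← intervalIntegral.integral_add_adjacent_intervals
    (hg _ (hx.mem_halfOpen 0) _ (hx.mem_halfOpen n))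
    (hg _ (hx.mem_halfOpen n) _ (hx.cell_subset n ht)), hnode, hG n t ht, zero_add]

theorem integral_restrictCell (hx : IsPartition b x) (w : L2 (halfOpen b)) (n : ℕ) {t : ℝ}
    (ht : t ∈ cell x n) : ∫ r in x n..t, hx.restrictCell n w r = ∫ r in x n..t, w r := by
  have hord := (isInterval_Icc (hx.step n)).ordConnected
  refine intervalIntegral.integral_congr_ae ?_
  filter_upwards [(ae_restrict_iff' measurableSet_Icc).1 (hx.restrictCell_ae n w)] with r hr hrm
  exact hr (hord.uIcc_subset (left_mem_Icc.2 (hx.step n).le) ht (uIoc_subset_uIcc hrm))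

/-- The representatives on the cells are glued by integrating `w` twice from `0`: both integrals
vanish at every node, so on each cell they agree with the given representatives. -/
theorem exists_isRep_of_cells (hx : IsPartition b x) {f w : L2 (halfOpen b)} {u v : ℕ → ℝ → ℂ}
    (h : ∀ n, IsRep (cell x n) (hx.restrictCell n f) (u n) (v n) (hx.restrictCell n w))
    (hu₀ : ∀ n, u n (x n) = 0) (hu₁ : ∀ n, u n (x (n + 1)) = 0)
    (hv₀ : ∀ n, v n (x n) = 0) (hv₁ : ∀ n, v n (x (n + 1)) = 0) :
    ∃ p q, IsRep (halfOpen b) f p q w ∧ ∀ t ∈ range x, p t = 0 ∧ q t = 0 := by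
  have hJ := hx.isInterval
  have h0 := hx.mem_halfOpen 0
  have hleft n : x n ∈ cell x n := left_mem_Icc.2 (hx.step n).le
  let q : ℝ → ℂ := fun t => ∫ r in x 0..t, w r
  let p : ℝ → ℂ := fun t => ∫ r in x 0..t, q r
  have hq₀ : q (x 0) = 0 := intervalIntegral.integral_same
  have hp₀ : p (x 0) = 0 := intervalIntegral.integral_same
  have hq : ContinuousOn q (halfOpen b) := continuousOn_of_eq_add_integral hJ.ordConnected h0
    one_le_two (Lp.memLp w) fun t _ => by rw [hq₀, zero_add]
  have hqv n t (ht : t ∈ cell x n) : q t = v n t := by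
    refine hx.integral_eq_of_cells (fun s hs t ht => L2.intervalIntegrable hJ w hs ht)
      (fun n t ht => ?_) hv₁ n ht
    rw [← hx.integral_restrictCell w n ht,
      (h n).integral_deriv_deriv (isInterval_Icc (hx.step n)) (hleft n) ht, hv₀, sub_zero]
  have hpu n t (ht : t ∈ cell x n) : p t = u n t := by
    refine hx.integral_eq_of_cells (fun s hs t ht =>
      (hq.mono (hJ.ordConnected.uIcc_subset hs ht)).intervalIntegrable) (fun n t ht => ?_) hu₁ n ht
    have hcell := isInterval_Icc (hx.step n)
    rw [intervalIntegral.integral_congr fun r hr =>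
        hqv n r (hcell.ordConnected.uIcc_subset (hleft n) ht hr),
      (h n).integral_deriv hcell (hleft n) ht, hu₀, sub_zero]
  refine ⟨p, q, IsRep.of_eq_add_integral hJ h0 (hx.ae_eq_of_cells fun n => ?_)
    (fun t _ => by rw [hp₀, zero_add]) (fun t _ => by rw [hq₀, zero_add]), ?_⟩
  · filter_upwards [(h n).ae_eq, hx.restrictCell_ae n f, ae_restrict_mem measurableSet_Icc]
      with t hu hf ht
    rw [← hf, hu, hpu n t ht]
  · rintro _ ⟨n, rfl⟩
    exact ⟨(hpu n _ (hleft n)).trans (hu₀ n), (hqv n _ (hleft n)).trans (hv₀ n)⟩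

theorem isDirectSumVia_Hmin (hx : IsPartition b x) :
    IsDirectSumVia hx.decomp hx.Hmin hx.cellOperator := by
  refine isDirectSumVia_iff.2 fun f g => ?_
  change _ ↔ ∀ n, (hx.restrictCell n f, hx.restrictCell n g) ∈ (hx.cellOperator n).graph
  constructor
  · intro h n
    obtain ⟨u, v, hr, h0⟩ := (mem_graph_minimalOperator _).1 h
    refine (mem_graph_minimalOperator _).2 ⟨u, v, ?_, ?_⟩
    · rw [← map_neg]
      exact hx.isRep_restrictCell hr n
    · rintro t (rfl | rfl) <;> exact h0 _ (mem_range_self _)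
  · intro h
    choose u v hr h0 using fun n => (mem_graph_minimalOperator _).1 (h n)
    refine (mem_graph_minimalOperator _).2 (hx.exists_isRep_of_cells (u := u) (v := v)
      (fun n => ?_) (fun n => (h0 n _ (by simp)).1) (fun n => (h0 n _ (by simp)).1)
      (fun n => (h0 n _ (by simp)).2) (fun n => (h0 n _ (by simp)).2))
    rw [map_neg]
    exact hr n

end IsPartition

theorem rpow_half_sq {d : ℝ} (hd : 0 ≤ d) : (d ^ (1 / 2 : ℝ)) ^ 2 = d := by
  rw [← Real.rpow_mul_natCast hd]
  norm_num

theorem rpow_half_cube {d : ℝ} (hd : 0 ≤ d) : (d ^ (1 / 2 : ℝ)) ^ 3 = d ^ (3 / 2 : ℝ) := by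
  rw [← Real.rpow_mul_natCast hd]
  norm_num

theorem ofReal_rpow_half_ne_zero {d : ℝ} (hd : 0 < d) : ((d ^ (1 / 2 : ℝ) : ℝ) : ℂ) ≠ 0 :=
  Complex.ofReal_ne_zero.2 (Real.rpow_pos_of_pos hd _).ne'

theorem ofReal_eq_rpow_half_sq {d : ℝ} (hd : 0 ≤ d) :
    (d : ℂ) = ((d ^ (1 / 2 : ℝ) : ℝ) : ℂ) ^ 2 :=
  mod_cast (rpow_half_sq hd).symm

theorem ofReal_rpow_three_halves {d : ℝ} (hd : 0 ≤ d) :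
    ((d ^ (3 / 2 : ℝ) : ℝ) : ℂ) = ((d ^ (1 / 2 : ℝ) : ℝ) : ℂ) ^ 3 :=
  mod_cast (rpow_half_cube hd).symm

section Interval

variable {a b : ℝ}

theorem isBoundaryTriplet_intervalOperator {H : Type*} [NormedAddCommGroup H]
    [InnerProductSpace ℂ H] [CompleteSpace H] (hab : a < b) {Γ₀ Γ₁ : L2 (Icc a b) →ₗ.[ℂ] H}
    {C : ℝ} (hG : GreenIdentity (intervalOperator hab) Γ₀ Γ₁)
    (hR : HasRightInverseBound (intervalOperator hab) Γ₀ Γ₁ C) (hC : 0 ≤ C)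
    (hdom₀ : Γ₀.domain = W22 (Icc a b)) (hdom₁ : Γ₁.domain = W22 (Icc a b)) :
    IsBoundaryTriplet (intervalOperator hab) Γ₀ Γ₁ := by
  have hdom : (intervalOperator hab).adjoint.domain = W22 (Icc a b) := by
    rw [adjoint_intervalOperator]
    rfl
  exact hG.isBoundaryTriplet hR hC (dense_domain_intervalOperator hab)
    (isClosed_intervalOperator hab) (intervalOperator_le_adjoint hab) (hdom₀.trans hdom.symm)
    (hdom₁.trans hdom.symm)

theorem exists_isRep_scaled_hermite (hab : a < b) (α β δ ε : ℂ) :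
    ∃ f u v z, IsRep (Icc a b) f u v z ∧
      ((b - a) ^ (1 / 2 : ℝ) : ℝ) * u a = α ∧ ((b - a) ^ (1 / 2 : ℝ) : ℝ) * u b = β ∧
      ((b - a : ℝ) * v a + (u a - u b)) / ((b - a) ^ (3 / 2 : ℝ) : ℝ) = δ ∧
      ((b - a : ℝ) * v b + (u a - u b)) / ((b - a) ^ (3 / 2 : ℝ) : ℝ) = ε ∧
      ‖f‖ ≤ 2 * ‖α‖ + ‖β‖ + (b - a) ^ 2 * (4 * ‖δ‖ + 2 * ‖ε‖) ∧
      ‖z‖ ≤ 10 * ‖δ‖ + 8 * ‖ε‖ := by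
  have hd : 0 < b - a := sub_pos.2 hab
  have hr : 0 < (b - a) ^ (1 / 2 : ℝ) := Real.rpow_pos_of_pos hd _
  have hsq := rpow_half_sq hd.le
  rw [← rpow_half_cube hd.le]
  set r : ℝ := (b - a) ^ (1 / 2 : ℝ)
  have hr' : (r : ℂ) ≠ 0 := Complex.ofReal_ne_zero.2 hr.ne'
  obtain ⟨f, u, v, z, hf, hua, hub, hva, hvb, hf_le, hz_le⟩ :=
    exists_isRep_hermite hab (α / r) (β / r) ((r ^ 3 : ℝ) * δ) ((r ^ 3 : ℝ) * ε)
  have hr3 : ((r ^ 3 : ℝ) : ℂ) ≠ 0 := Complex.ofReal_ne_zero.2 (pow_pos hr 3).ne'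
  change _ ≤ r * _ at hf_le hz_le
  simp only [norm_div, norm_mul, Complex.norm_real, Real.norm_of_nonneg hr.le,
    Real.norm_of_nonneg (pow_pos hr 3).le] at hf_le hz_le
  refine ⟨f, u, v, z, hf, ?_, ?_, ?_, ?_, hf_le.trans_eq ?_, hz_le.trans_eq ?_⟩
  · rw [hua, mul_div_cancel₀ _ hr']
  · rw [hub, mul_div_cancel₀ _ hr']
  · rw [hva, mul_div_cancel_left₀ _ hr3]
  · rw [hvb, mul_div_cancel_left₀ _ hr3]
  · rw [← hsq]
    field_simp
    ring
  · rw [← hsq]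
    field_simp

theorem sq_add_sq_le_of_le_add_mul {m k X Y d : ℝ} (hm : 0 ≤ m) (hk : 0 ≤ k)
    (hm_le : m ≤ 4 * X + d ^ 2 * (11 * Y)) (hk_le : k ≤ 28 * Y) :
    m ^ 2 + k ^ 2 ≤ (784 + 242 * d ^ 4) * (X ^ 2 + Y ^ 2) := by
  have hm_sq := pow_le_pow_left₀ hm hm_le 2
  have hk_sq := pow_le_pow_left₀ hk hk_le 2
  have hX : 0 ≤ d ^ 4 * X ^ 2 := by positivity
  nlinarith [sq_nonneg (4 * X - d ^ 2 * (11 * Y)), sq_nonneg X]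

theorem IsRep.rep_eq {J : Set ℝ} (hJ : IsInterval J) {f w : L2 J} {u v : ℝ → ℂ}
    (h : IsRep J f u v w) (hf : f ∈ W22 J) {t : ℝ} (ht : t ∈ J) :
    rep ⟨f, hf⟩ t = u t :=
  ((isRep ⟨f, hf⟩).unique hJ h).1 ht

theorem IsRep.repDeriv_eq {J : Set ℝ} (hJ : IsInterval J) {f w : L2 J} {u v : ℝ → ℂ}
    (h : IsRep J f u v w) (hf : f ∈ W22 J) {t : ℝ} (ht : t ∈ J) :
    repDeriv ⟨f, hf⟩ t = v t :=
  ((isRep ⟨f, hf⟩).unique hJ h).2.1 ht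

section BoundaryValues

variable {f w : L2 (Icc a b)} {u v : ℝ → ℂ} {k : EuclideanSpace ℂ (Fin 2)}

theorem mem_graph_gammaZeroA (hab : a < b) (hf : IsRep (Icc a b) f u v w) :
    (f, k) ∈ (gammaZeroA hab).graph ↔
      k = !₂[(((b - a) ^ (1 / 2 : ℝ) : ℝ) : ℂ) * u a,
        -(((b - a) ^ (1 / 2 : ℝ) : ℝ) : ℂ) * u b] := by
  have hmem : f ∈ W22 (Icc a b) := ⟨u, v, w, hf⟩
  have hJ := isInterval_Icc hab
  rw [← hf.rep_eq hJ hmem (left_mem_Icc.2 hab.le), ← hf.rep_eq hJ hmem (right_mem_Icc.2 hab.le)]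
  exact (LinearPMap.image_iff hmem).symm

theorem mem_graph_gammaOneA (hab : a < b) (hf : IsRep (Icc a b) f u v w) :
    (f, k) ∈ (gammaOneA hab).graph ↔
      k = !₂[(((b - a : ℝ) : ℂ) * v a + (u a - u b)) / (((b - a) ^ (3 / 2 : ℝ) : ℝ) : ℂ),
        (((b - a : ℝ) : ℂ) * v b + (u a - u b)) / (((b - a) ^ (3 / 2 : ℝ) : ℝ) : ℂ)] := by
  have hmem : f ∈ W22 (Icc a b) := ⟨u, v, w, hf⟩
  have hJ := isInterval_Icc hab
  rw [← hf.rep_eq hJ hmem (left_mem_Icc.2 hab.le), ← hf.rep_eq hJ hmem (right_mem_Icc.2 hab.le),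
    ← hf.repDeriv_eq hJ hmem (left_mem_Icc.2 hab.le),
    ← hf.repDeriv_eq hJ hmem (right_mem_Icc.2 hab.le)]
  exact (LinearPMap.image_iff hmem).symm

theorem mem_graph_gammaZeroB (hab : a < b) (hf : IsRep (Icc a b) f u v w) :
    (f, k) ∈ (gammaZeroB hab).graph ↔
      k = !₂[(((b - a) ^ (1 / 2 : ℝ) : ℝ) : ℂ) * u a,
        (((b - a) ^ (3 / 2 : ℝ) : ℝ) : ℂ) * v b] := by
  have hmem : f ∈ W22 (Icc a b) := ⟨u, v, w, hf⟩
  have hJ := isInterval_Icc hab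
  rw [← hf.rep_eq hJ hmem (left_mem_Icc.2 hab.le),
    ← hf.repDeriv_eq hJ hmem (right_mem_Icc.2 hab.le)]
  exact (LinearPMap.image_iff hmem).symm

theorem mem_graph_gammaOneB (hab : a < b) (hf : IsRep (Icc a b) f u v w) :
    (f, k) ∈ (gammaOneB hab).graph ↔
      k = !₂[(v a - v b) / (((b - a) ^ (1 / 2 : ℝ) : ℝ) : ℂ),
        (u b - u a - ((b - a : ℝ) : ℂ) * v b) / (((b - a) ^ (3 / 2 : ℝ) : ℝ) : ℂ)] := by
  have hmem : f ∈ W22 (Icc a b) := ⟨u, v, w, hf⟩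
  have hJ := isInterval_Icc hab
  rw [← hf.rep_eq hJ hmem (left_mem_Icc.2 hab.le), ← hf.rep_eq hJ hmem (right_mem_Icc.2 hab.le),
    ← hf.repDeriv_eq hJ hmem (left_mem_Icc.2 hab.le),
    ← hf.repDeriv_eq hJ hmem (right_mem_Icc.2 hab.le)]
  exact (LinearPMap.image_iff hmem).symm

end BoundaryValues

theorem greenIdentity_gammaA (hab : a < b) :
    GreenIdentity (intervalOperator hab) (gammaZeroA hab) (gammaOneA hab) := by
  intro f f' g g' f₀ f₁ g₀ g₁ hf hg hf₀ hf₁ hg₀ hg₁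
  obtain ⟨u, v, hu⟩ := (mem_graph_adjoint_intervalOperator hab).1 hf
  obtain ⟨p, q, hp⟩ := (mem_graph_adjoint_intervalOperator hab).1 hg
  obtain rfl := (mem_graph_gammaZeroA hab hu).1 hf₀
  obtain rfl := (mem_graph_gammaOneA hab hu).1 hf₁
  obtain rfl := (mem_graph_gammaZeroA hab hp).1 hg₀
  obtain rfl := (mem_graph_gammaOneA hab hp).1 hg₁
  have hgreen := hu.green hab hp
  rw [inner_neg_left, inner_neg_right] at hgreen
  simp only [← starRingEnd_apply] at hgreen
  have hd := sub_pos.2 hab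
  have hr := ofReal_rpow_half_ne_zero hd
  rw [ofReal_rpow_three_halves hd.le, ofReal_eq_rpow_half_sq hd.le]
  generalize (b - a) ^ (1 / 2 : ℝ) = r at hr
  simp only [PiLp.inner_apply, Fin.sum_univ_two, RCLike.inner_apply, Matrix.cons_val_zero,
    Matrix.cons_val_one, map_mul, map_neg, map_div₀, map_add, map_sub, map_pow,
    Complex.conj_ofReal]
  field_simp
  linear_combination -r ^ 2 * hgreen

theorem hasRightInverseBound_gammaA (hab : a < b) :
    HasRightInverseBound (intervalOperator hab) (gammaZeroA hab) (gammaOneA hab)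
      (784 + 242 * (b - a) ^ 4) := by
  intro h₀ h₁
  obtain ⟨f, u, v, w, hf, hua, hub, hva, hvb, hf_le, hw_le⟩ :=
    exists_isRep_scaled_hermite hab (h₀ 0) (-h₀ 1) (h₁ 0) (h₁ 1)
  have hX := PiLp.norm_apply_le h₀
  have hY := PiLp.norm_apply_le h₁
  rw [norm_neg] at hf_le
  refine ⟨f, -w, (mem_graph_adjoint_intervalOperator hab).2 ⟨u, v, by rwa [neg_neg]⟩,
    (mem_graph_gammaZeroA hab hf).2 ?_, (mem_graph_gammaOneA hab hf).2 ?_, ?_⟩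
  · rw [neg_mul, hua, hub, neg_neg]
    ext i
    fin_cases i <;> rfl
  · rw [hva, hvb]
    ext i
    fin_cases i <;> rfl
  · refine sq_add_sq_le_of_le_add_mul (norm_nonneg _) (norm_nonneg _) (hf_le.trans ?_) ?_
    · gcongr
      · linarith [hX 0, hX 1, norm_nonneg h₀]
      · linarith [hY 0, hY 1, norm_nonneg h₁]
    · rw [norm_neg]
      linarith [hY 0, hY 1, norm_nonneg h₁]

theorem greenIdentity_gammaB (hab : a < b) :
    GreenIdentity (intervalOperator hab) (gammaZeroB hab) (gammaOneB hab) := by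
  intro f f' g g' f₀ f₁ g₀ g₁ hf hg hf₀ hf₁ hg₀ hg₁
  obtain ⟨u, v, hu⟩ := (mem_graph_adjoint_intervalOperator hab).1 hf
  obtain ⟨p, q, hp⟩ := (mem_graph_adjoint_intervalOperator hab).1 hg
  obtain rfl := (mem_graph_gammaZeroB hab hu).1 hf₀
  obtain rfl := (mem_graph_gammaOneB hab hu).1 hf₁
  obtain rfl := (mem_graph_gammaZeroB hab hp).1 hg₀
  obtain rfl := (mem_graph_gammaOneB hab hp).1 hg₁
  have hgreen := hu.green hab hp
  rw [inner_neg_left, inner_neg_right] at hgreen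
  simp only [← starRingEnd_apply] at hgreen
  have hd := sub_pos.2 hab
  have hr := ofReal_rpow_half_ne_zero hd
  rw [ofReal_rpow_three_halves hd.le, ofReal_eq_rpow_half_sq hd.le]
  generalize (b - a) ^ (1 / 2 : ℝ) = r at hr
  simp only [PiLp.inner_apply, Fin.sum_univ_two, RCLike.inner_apply, Matrix.cons_val_zero,
    Matrix.cons_val_one, map_mul, map_div₀, map_sub, map_pow, Complex.conj_ofReal]
  field_simp
  linear_combination -hgreen

theorem regularizedB_of_scaled_hermite {K : Type*} [Field K] {r ua ub va vb α β δ ε : K}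
    (hr : r ≠ 0) (hua : r * ua = α) (hub : r * ub = α + β + (r ^ 2) ^ 2 * ε)
    (hva : (r ^ 2 * va + (ua - ub)) / r ^ 3 = δ - ε)
    (hvb : (r ^ 2 * vb + (ua - ub)) / r ^ 3 = -ε) :
    r ^ 3 * vb = β ∧ (va - vb) / r = δ ∧ (ub - ua - r ^ 2 * vb) / r ^ 3 = ε := by
  rw [div_eq_iff (pow_ne_zero 3 hr)] at hva hvb
  refine ⟨by linear_combination r * hvb - hua + hub, ?_, ?_⟩
  · refine (div_eq_iff hr).2 (mul_left_cancel₀ (pow_ne_zero 2 hr) ?_)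
    linear_combination hva - hvb
  · rw [div_eq_iff (pow_ne_zero 3 hr)]
    linear_combination -hvb

theorem hasRightInverseBound_gammaB (hab : a < b) :
    HasRightInverseBound (intervalOperator hab) (gammaZeroB hab) (gammaOneB hab)
      (784 + 242 * (b - a) ^ 4) := by
  intro h₀ h₁
  obtain ⟨f, u, v, w, hf, hua, hub, hva, hvb, hf_le, hw_le⟩ :=
    exists_isRep_scaled_hermite hab (h₀ 0) (h₀ 0 + h₀ 1 + (b - a : ℝ) ^ 2 * h₁ 1)
      (h₁ 0 - h₁ 1) (-h₁ 1)
  have hX := PiLp.norm_apply_le h₀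
  have hY := PiLp.norm_apply_le h₁
  have hd := sub_pos.2 hab
  rw [ofReal_rpow_three_halves hd.le] at hva hvb
  rw [ofReal_eq_rpow_half_sq hd.le] at hub hva hvb
  obtain ⟨hvb', hdiff, hincr⟩ :=
    regularizedB_of_scaled_hermite (ofReal_rpow_half_ne_zero hd) hua hub hva hvb
  rw [← ofReal_rpow_three_halves hd.le] at hvb' hincr
  rw [← ofReal_eq_rpow_half_sq hd.le] at hincr
  refine ⟨f, -w, (mem_graph_adjoint_intervalOperator hab).2 ⟨u, v, by rwa [neg_neg]⟩,
    (mem_graph_gammaZeroB hab hf).2 ?_, (mem_graph_gammaOneB hab hf).2 ?_, ?_⟩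
  · rw [hua, hvb']
    ext i
    fin_cases i <;> rfl
  · rw [hdiff, hincr]
    ext i
    fin_cases i <;> rfl
  · have hsub := norm_sub_le (h₁ 0) (h₁ 1)
    have hadd : ‖h₀ 0 + h₀ 1 + (b - a : ℝ) ^ 2 * h₁ 1‖ ≤
        ‖h₀ 0‖ + ‖h₀ 1‖ + (b - a) ^ 2 * ‖h₁ 1‖ :=
      norm_add₃_le.trans_eq <| by
        rw [norm_mul, norm_pow, Complex.norm_real, Real.norm_eq_abs, sq_abs]
    rw [norm_neg] at hf_le hw_le
    refine sq_add_sq_le_of_le_add_mul (norm_nonneg _) (norm_nonneg _) ?_ ?_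
    · nlinarith [hX 0, hX 1, hY 0, hY 1, sq_nonneg (b - a)]
    · rw [norm_neg]
      linarith [hY 0, hY 1]

theorem isBoundaryTriplet_gammaA (hab : a < b) :
    IsBoundaryTriplet (intervalOperator hab) (gammaZeroA hab) (gammaOneA hab) :=
  isBoundaryTriplet_intervalOperator hab (greenIdentity_gammaA hab)
    (hasRightInverseBound_gammaA hab) (by positivity) rfl rfl

theorem isBoundaryTriplet_gammaB (hab : a < b) :
    IsBoundaryTriplet (intervalOperator hab) (gammaZeroB hab) (gammaOneB hab) :=
  isBoundaryTriplet_intervalOperator hab (greenIdentity_gammaB hab)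
    (hasRightInverseBound_gammaB hab) (by positivity) rfl rfl

end Interval

theorem IsPartition.isBoundaryTriplet_boundarySum {b : EReal} {x : ℕ → ℝ} (hx : IsPartition b x)
    {Γ₀ Γ₁ : ∀ n, L2 (IsPartition.cell x n) →ₗ.[ℂ] EuclideanSpace ℂ (Fin 2)} {C : ℝ}
    (hC : 0 ≤ C) (hT : ∀ n, IsBoundaryTriplet (hx.cellOperator n) (Γ₀ n) (Γ₁ n))
    (hR : ∀ n, HasRightInverseBound (hx.cellOperator n) (Γ₀ n) (Γ₁ n) C) :
    IsBoundaryTriplet hx.Hmin (hx.boundarySum Γ₀) (hx.boundarySum Γ₁) :=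
  IsBoundaryTriplet.directSum hx.isDirectSumVia_Hmin hC hT hR

end BoundaryTriplets

theorem mainTheorem4 (b : EReal) (x : ℕ → ℝ) (hx : IsPartition b x)
    (hd : BddAbove (Set.range fun n => x (n + 1) - x n)) :
    -- `H_min = ⊕ Hₙ` and `H_min† = ⊕ Hₙ†`, under the identification of `L²[0, b)` with `⊕ L²[xₙ, xₙ₊₁]`
    hx.decomp.toLinearEquiv.toLinearMap.compPMap hx.Hmin =
        pullback (directSum fun n => hx.cellOperator n) hx.decomp.toLinearEquiv.toLinearMap ∧
    hx.decomp.toLinearEquiv.toLinearMap.compPMap hx.Hmin.adjoint =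
        pullback (directSum fun n => (hx.cellOperator n).adjoint)
          hx.decomp.toLinearEquiv.toLinearMap ∧
    -- the first regularized triplets
    (∀ n, IsBoundaryTriplet (hx.cellOperator n) (gammaZeroA (hx.step n)) (gammaOneA (hx.step n))) ∧
    IsBoundaryTriplet hx.Hmin (hx.boundarySum fun n => gammaZeroA (hx.step n))
      (hx.boundarySum fun n => gammaOneA (hx.step n)) ∧
    -- the second regularized triplets
    (∀ n, IsBoundaryTriplet (hx.cellOperator n) (gammaZeroB (hx.step n)) (gammaOneB (hx.step n))) ∧
    IsBoundaryTriplet hx.Hmin (hx.boundarySum fun n => gammaZeroB (hx.step n))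
      (hx.boundarySum fun n => gammaOneB (hx.step n)) := by
  obtain ⟨D, hD⟩ := hd
  have hlen (n : ℕ) : 784 + 242 * (x (n + 1) - x n) ^ 4 ≤ 784 + 242 * D ^ 4 := by
    have := (sub_pos.2 (hx.step n)).le
    gcongr
    exact hD ⟨n, rfl⟩
  have hC : 0 ≤ 784 + 242 * D ^ 4 := by positivity
  have hsum := hx.isDirectSumVia_Hmin
  have hA := fun n => isBoundaryTriplet_gammaA (hx.step n)
  have hB := fun n => isBoundaryTriplet_gammaB (hx.step n)
  exact ⟨hsum, hsum.adjoint fun n => dense_domain_intervalOperator (hx.step n),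
    hA, hx.isBoundaryTriplet_boundarySum hC hA
      fun n => (hasRightInverseBound_gammaA (hx.step n)).mono (hlen n),
    hB, hx.isBoundaryTriplet_boundarySum hC hB
      fun n => (hasRightInverseBound_gammaB (hx.step n)).mono (hlen n)⟩
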